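/- Let $M$ be a smooth finite-dimensional manifold, $\mathbb TM=TM\oplus T^*M$ with pairing $\langle X+\xi,Y+\eta\rangle=\eta(X)+\xi(Y)$ and anchor $\rho:\mathbb TM\to TM$ the projection, and let $H$ be a three-form on $M$ (closed in the case of an exact Courant algebroid; closedness is not needed). Let $D=\nabla+V$ be a generalized connection on $\mathbb TM$, i.e. $D_a(f\sigma)=fD_a\sigma+\rho(a)(f)\,\sigma$, with $\nabla_X=D_{X+0}$ a connection on $\mathbb TM$ and $V_\nu=D_{0+\nu}$ a tensor $V\in\Gamma(TM\otimes\mathrm{End}\,\mathbb TM)$. Write $\nabla^{TT},\nabla^{TT^*},\nabla^{T^*T},\nabla^{T^*T^*}$ and $V^{TT},V^{TT^*},V^{T^*T},V^{T^*T^*}$ for the blocks of $\nabla$ and $V$ (first superscript: target, second: source). Let $\nabla^K$ be an affine connection on $M$, acting on one-forms by duality. The $K$-torsion of $D$ is $$T^K_D(X+\xi,Y+\eta)=\big(\nabla_XY-\nabla_YX-[X,Y]+H(X,Y,\cdot)\big)+\big(V_\xi\eta-V_\eta\xi\big)+\tau(X,\eta)-\tau(Y,\xi),\qquad \tau(X,\nu)=\nabla_X\nu-\nabla^K_X\nu-V_\nu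 X,$$ and its $K$-curvature is $$R^K_D(X+\xi,Y+\eta)=[\nabla_X,\nabla_Y]-\nabla_{[X,Y]}+V_{H(X,Y,\cdot)}+[V_\xi,V_\eta]+(\nabla^{K}_XV)_\eta-(\nabla^{K}_YV)_\xi,\qquad (\nabla^{K}_XV)_\nu=[\nabla_X,V_\nu]-V_{\nabla^K_X\nu}.$$ Assume that $T^K_D=0$ and that $D$ is compatible with the pairing: $\rho(a)\langle b,c\rangle=\langle D_ab,c\rangle+\langle b,D_ac\rangle$. Then: (1) $\nabla^K$ is fixed by $D$: $\nabla^K_X\nu=\nabla^{T^*T^*}_X\nu-V^{T^*T}_\nu X$ for all vector fields $X$ and one-forms $\nu$. (2) $\nabla^{TT}$ is a torsion-free connection on $TM$, and $$D=\begin{pmatrix}\nabla^{TT}&0\\ \tfrac12H+\gamma&(\nabla^{TT})^*\end{pmatrix}+\begin{pmatrix}0&V^{TT^*}\\ V^{T^*T}&0\end{pmatrix}.$$ Here $(\nabla^{TT})^*$ is the dual connection on $T^*M$. The lower left entry of the first matrix, with components $\langle\nabla_{e_\mu}e_\rho,e_\nu\rangle$, equals $\tfrac12H_{\mu\nu\rho}+\gamma_{\mu\nu\rho}$,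 where $\gamma_{\mu\nu\rho}$ is symmetric in $(\mu,\rho)$ and antisymmetric in $(\nu,\rho)$. Moreover $V^{T^*T}\in\Gamma(TM\otimes\Lambda^2T^*M)$, and $V^{TT^*}\in\Gamma(TM\otimes\Lambda^2TM)$ is symmetric in its first and third entries. (These symmetries force $\gamma=0$ and $V^{TT^*}=0$.) (3) Let $g$ be a Riemannian metric and $B$ a two-form on $M$, and let $$G=\begin{pmatrix}g-Bg^{-1}B&Bg^{-1}\\-g^{-1}B&g^{-1}\end{pmatrix}$$ be the corresponding generalized metric, with blocks $G_{\mu\nu},\ G_\mu{}^\nu,\ G^\mu{}_\nu,\ G^{\mu\nu}$. For a local frame $(e_\mu)$ of $TM$ with dual coframe $(e^\mu)$ put $E_\alpha=(e_\mu,e^\mu)$, let $E^\alpha=(e^\mu,e_\mu)$ be the dual basis for the pairing, $\mathrm{Ric}^K_{\alpha\beta}=\langle E^\gamma,R^K_D(E_\gamma,E_\alpha)E_\beta\rangle$ and $\mathrm{Scal}^K=G^{\alpha\beta}\mathrm{Ric}^K_{\alpha\beta}$, where $G^{\alpha\beta}=G(E^\alpha,E^\beta)$. Then $$\mathrm{Scal}^K=\mathrm{Scal}(g,\nabla^{TT})+G_{\mu\nu}\big(\nabla_\rho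 V^{\mu\rho\nu}+V^\sigma{}_{\sigma\rho}V^{\mu\rho\nu}\big)-G^{\mu\nu}\big(\nabla_\mu V^\sigma{}_{\sigma\nu}+V^\sigma{}_{\rho\mu}V^\rho{}_{\sigma\nu}\big).$$ Here $V^{\mu\nu\rho}=\langle V^{TT^*}_{e^\mu}e^\rho,e^\nu\rangle$, $V^\mu{}_{\nu\rho}=\langle V^{T^*T}_{e^\mu}e_\rho,e_\nu\rangle$, covariant derivatives of these tensors are taken with $\nabla^{TT}$, and $\mathrm{Scal}(g,\nabla^{TT})=g^{\mu\nu}\langle e^\rho,R_{\nabla^{TT}}(e_\rho,e_\mu)e_\nu\rangle$. If the frame is holonomic, i.e. $[e_\mu,e_\nu]=0$ for all $\mu,\nu$, then, with $\nabla^{TT}_{e_\mu}e_\nu=\Gamma_\mu{}^\rho{}_\nu e_\rho$ and $\partial_\mu$ the derivative along $e_\mu$, $$\mathrm{Scal}(g,\nabla^{TT})=G^{\mu\nu}\big(\partial_\rho\Gamma_\mu{}^\rho{}_\nu-\partial_\mu\Gamma_\rho{}^\rho{}_\nu+\Gamma_\rho{}^\rho{}_\sigma\Gamma_\mu{}^\sigma{}_\nu-\Gamma_\mu{}^\rho{}_\sigma\Gamma_\rho{}^\sigma{}_\nu\big).$$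 -/

import Mathlib

open Bundle Set
open scoped Manifold ContDiff Topology

noncomputable section

namespace CourantGeom

/-! ### The generalized tangent bundle `𝕋M = TM ⊕ T*M` of a smooth manifold -/

section Basics

variable (E : Type*) [NormedAddCommGroup E] [NormedSpace ℝ E]
  (M : Type*) [TopologicalSpace M] [ChartedSpace E M]

/-- Vector fields, as arbitrary functions; smoothness is always stated separately. -/
abbrev VField := Π x : M, TangentSpace 𝓘(ℝ, E) x

/-- Covector fields (one-forms), as arbitrary functions. -/
abbrev CoField := Π x : M, (TangentSpace 𝓘(ℝ, E) x →L[ℝ] ℝ)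

variable {M} in
/-- The fibre `T_x M ⊕ T_x^* M` of the generalized tangent bundle. -/
abbrev GenTangent (x : M) := TangentSpace 𝓘(ℝ, E) x × (TangentSpace 𝓘(ℝ, E) x →L[ℝ] ℝ)

/-- Sections of `𝕋M`, as arbitrary functions. -/
abbrev GenField := Π x : M, GenTangent E x

end Basics

section Sections

variable {E : Type*} [NormedAddCommGroup E] [NormedSpace ℝ E]
  {M : Type*} [TopologicalSpace M] [ChartedSpace E M] [IsManifold 𝓘(ℝ, E) ∞ M]

/-- The vector field `X` is `C^∞` at `x`. -/
def VSmoothAt (X : VField E M) (x : M) : Prop :=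
  ContMDiffAt 𝓘(ℝ, E) (𝓘(ℝ, E).prod 𝓘(ℝ, E)) ∞
    (fun y ↦ TotalSpace.mk' E (E := fun z : M ↦ TangentSpace 𝓘(ℝ, E) z) y (X y)) x

/-- The covector field `ξ` is `C^∞` at `x`. -/
def CoSmoothAt (ξ : CoField E M) (x : M) : Prop :=
  ContMDiffAt 𝓘(ℝ, E) (𝓘(ℝ, E).prod 𝓘(ℝ, E →L[ℝ] ℝ)) ∞
    (fun y ↦ TotalSpace.mk' (E →L[ℝ] ℝ)
      (E := fun z : M ↦ (TangentSpace 𝓘(ℝ, E) z →L[ℝ] ℝ)) y (ξ y)) x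

/-- The vector field `X` is differentiable at `x`. -/
def VDiffAt (X : VField E M) (x : M) : Prop :=
  MDifferentiableAt 𝓘(ℝ, E) (𝓘(ℝ, E).prod 𝓘(ℝ, E))
    (fun y ↦ TotalSpace.mk' E (E := fun z : M ↦ TangentSpace 𝓘(ℝ, E) z) y (X y)) x

/-- The covector field `ξ` is differentiable at `x`. -/
def CoDiffAt (ξ : CoField E M) (x : M) : Prop :=
  MDifferentiableAt 𝓘(ℝ, E) (𝓘(ℝ, E).prod 𝓘(ℝ, E →L[ℝ] ℝ))
    (fun y ↦ TotalSpace.mk' (E →L[ℝ] ℝ)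
      (E := fun z : M ↦ (TangentSpace 𝓘(ℝ, E) z →L[ℝ] ℝ)) y (ξ y)) x

/-- A section of the Whitney sum `TM ⊕ T*M` is `C^∞` at `x` iff both components are. -/
def GenSmoothAt (a : GenField E M) (x : M) : Prop :=
  VSmoothAt (fun y ↦ (a y).1) x ∧ CoSmoothAt (fun y ↦ (a y).2) x

/-- A section of the Whitney sum `TM ⊕ T*M` is differentiable at `x` iff both components are. -/
def GenDiffAt (a : GenField E M) (x : M) : Prop :=
  VDiffAt (fun y ↦ (a y).1) x ∧ CoDiffAt (fun y ↦ (a y).2) x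

/-- The section `X + 0` of `𝕋M`. -/
def ofVec (X : VField E M) : GenField E M := fun x ↦ (X x, 0)

/-- The section `0 + ξ` of `𝕋M`. -/
def ofCov (ξ : CoField E M) : GenField E M := fun x ↦ (0, ξ x)

/-- The canonical pairing `⟨X + ξ, Y + η⟩ = η(X) + ξ(Y)` on `𝕋M`. -/
def pairing {x : M} (a b : GenTangent E x) : ℝ := b.2 a.1 + a.2 b.1

/-- The derivative `X(f)(x)` of the function `f` along the tangent vector `X ∈ T_x M`. -/
def dirDeriv (f : M → ℝ) (x : M) (X : TangentSpace 𝓘(ℝ, E) x) : ℝ :=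
  mvfderiv 𝓘(ℝ, E) f x X

lemma vDiffAt_zero (x : M) : VDiffAt (fun _ ↦ 0 : VField E M) x :=
  mdifferentiableAt_zeroSection ℝ (fun z : M ↦ TangentSpace 𝓘(ℝ, E) z) (x := x)

lemma coDiffAt_zero (x : M) : CoDiffAt (fun _ ↦ 0 : CoField E M) x :=
  mdifferentiableAt_zeroSection ℝ (fun z : M ↦ (TangentSpace 𝓘(ℝ, E) z →L[ℝ] ℝ)) (x := x)

/-! ### Affine connections and the induced connection on `T*M` -/

variable (E M) in
/-- Affine connections on `M`, i.e. connections on `TM`; `cov Y x (X x)` is `(∇_X Y)(x)`. -/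
abbrev AffineConn := CovariantDerivative 𝓘(ℝ, E) E (fun x : M ↦ TangentSpace 𝓘(ℝ, E) x)

lemma eval_mdifferentiableAt {ν : CoField E M} {Y : VField E M} {x : M}
    (hν : CoDiffAt ν x) (hY : VDiffAt Y x) :
    MDifferentiableAt 𝓘(ℝ, E) 𝓘(ℝ, ℝ) (fun y ↦ ν y (Y y)) x := by
  have h := MDifferentiableAt.clm_bundle_apply (F₁ := E) (F₂ := ℝ)
    (E₁ := fun z : M ↦ TangentSpace 𝓘(ℝ, E) z) (E₂ := Bundle.Trivial M ℝ)
    (ϕ := ν) (v := Y) (b := fun y ↦ y) hν hY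
  rw [mdifferentiableAt_totalSpace] at h
  exact h.2

lemma dual_tensorial (cov : AffineConn E M) {ν : CoField E M} {x : M} (hν : CoDiffAt ν x)
    (X : TangentSpace 𝓘(ℝ, E) x) :
    TensorialAt 𝓘(ℝ, E) E
      (fun Y : VField E M ↦ dirDeriv (fun y ↦ ν y (Y y)) x X - ν x (cov Y x X)) x where
  smul := by
    intro f Y hf hY
    have h1 : (fun y ↦ ν y ((f • Y) y)) = f • fun y ↦ ν y (Y y) := by
      funext y; simp
    have h2 := cov.isCovariantDerivativeOnUniv.leibniz hY hf
    have h3 := mvfderiv_smul hf (eval_mdifferentiableAt hν hY)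
    simp only [dirDeriv]
    rw [h1, h3, h2]
    simp
    ring
  add := by
    intro Y Y' hY hY'
    have h1 : (fun y ↦ ν y ((Y + Y') y)) = (fun y ↦ ν y (Y y)) + fun y ↦ ν y (Y' y) := by
      funext y; simp
    have h2 := cov.isCovariantDerivativeOnUniv.add hY hY'
    have h3 := mvfderiv_add (eval_mdifferentiableAt hν hY) (eval_mdifferentiableAt hν hY')
    simp only [dirDeriv]
    rw [h1, h3, h2]
    simp
    ring

variable [FiniteDimensional ℝ E]

open scoped Classical in
/-- The connection on `T*M` induced by an affine connection: `(∇_X ν)(Y) = X(ν(Y)) - ν(∇_X Y)`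
for `X ∈ T_x M` and `ν` differentiable at `x` (see `dualAt_apply`). -/
def dualAt (cov : AffineConn E M) (ν : CoField E M) (x : M) (X : TangentSpace 𝓘(ℝ, E) x) :
    TangentSpace 𝓘(ℝ, E) x →L[ℝ] ℝ :=
  if hν : CoDiffAt ν x then TensorialAt.mkHom _ x (dual_tensorial cov hν X) else 0

lemma dualAt_apply (cov : AffineConn E M) {ν : CoField E M} {Y : VField E M} {x : M}
    (hν : CoDiffAt ν x) (hY : VDiffAt Y x) (X : TangentSpace 𝓘(ℝ, E) x) :
    dualAt cov ν x X (Y x) = dirDeriv (fun y ↦ ν y (Y y)) x X - ν x (cov Y x X) := by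
  rw [dualAt, dif_pos hν]
  exact TensorialAt.mkHom_apply (dual_tensorial cov hν X) hY

/-! ### Tensors on `M` -/

variable (E M) in
/-- Smooth two-forms on `M`. -/
structure TwoForm where
  /-- The value at a point. -/
  toFun (x : M) : TangentSpace 𝓘(ℝ, E) x →L[ℝ] TangentSpace 𝓘(ℝ, E) x →L[ℝ] ℝ
  alt (x : M) (u : TangentSpace 𝓘(ℝ, E) x) : toFun x u u = 0
  smooth {X : VField E M} {x : M} (hX : VSmoothAt X x) :
    CoSmoothAt (fun y ↦ toFun y (X y)) x

variable (E M) in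
/-- Smooth three-forms on `M`. -/
structure ThreeForm where
  /-- The value at a point. -/
  toFun (x : M) : TangentSpace 𝓘(ℝ, E) x →L[ℝ] TangentSpace 𝓘(ℝ, E) x →L[ℝ]
    TangentSpace 𝓘(ℝ, E) x →L[ℝ] ℝ
  alt_left (x : M) (u w : TangentSpace 𝓘(ℝ, E) x) : toFun x u u w = 0
  alt_right (x : M) (u w : TangentSpace 𝓘(ℝ, E) x) : toFun x u w w = 0
  smooth {X Y : VField E M} {x : M} (hX : VSmoothAt X x) (hY : VSmoothAt Y x) :
    CoSmoothAt (fun y ↦ toFun y (X y) (Y y)) x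

variable (E M) in
/-- Smooth Riemannian metrics on `M`. -/
abbrev Metric := ContMDiffRiemannianMetric 𝓘(ℝ, E) ∞ E (fun x : M ↦ TangentSpace 𝓘(ℝ, E) x)

/-! ### Generalized connections on `𝕋M` -/

variable (E M) in
/-- A generalized connection `D` on `𝕋M`: a first order operator with
`D(fσ) = f Dσ + (ρ^* df) ⊗ σ`, where the anchor `ρ : 𝕋M → TM` is the projection.
The value `toFun σ x a` is `(D_a σ)(x)`, for `a ∈ 𝕋_x M`. -/
structure GenConn where
  /-- The operator `σ ↦ (a ↦ D_a σ)`. -/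
  toFun : GenField E M → Π x : M, GenTangent E x →L[ℝ] GenTangent E x
  add {σ τ : GenField E M} {x : M} (hσ : GenDiffAt σ x) (hτ : GenDiffAt τ x) :
    toFun (fun y ↦ σ y + τ y) x = toFun σ x + toFun τ x
  leibniz {f : M → ℝ} {σ : GenField E M} {x : M}
    (hf : MDifferentiableAt 𝓘(ℝ, E) 𝓘(ℝ, ℝ) f x) (hσ : GenDiffAt σ x) (a : GenTangent E x) :
    toFun (fun y ↦ f y • σ y) x a = f x • toFun σ x a + dirDeriv f x a.1 • σ x
  smooth {a σ : GenField E M} {x : M} (ha : GenSmoothAt a x) (hσ : GenSmoothAt σ x) :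
    GenSmoothAt (fun y ↦ toFun σ y (a y)) x

namespace GenConn

variable (D : GenConn E M)

/-- `∇_X σ`, where `D = ∇ + V`: the derivative in the direction of `X + 0`. -/
def nabla (X : VField E M) (σ : GenField E M) : GenField E M :=
  fun x ↦ D.toFun σ x (X x, 0)

/-- `V_ν σ`, where `D = ∇ + V`: the derivative in the direction of `0 + ν`. -/
def vPart (ν : CoField E M) (σ : GenField E M) : GenField E M :=
  fun x ↦ D.toFun σ x (0, ν x)

/-- The connection `∇^{TT}` on `TM`, i.e. the `TM`-`TM` block of `∇`. -/
def nablaTT : AffineConn E M where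
  toFun Y x := ContinuousLinearMap.fst ℝ _ _ ∘L D.toFun (ofVec Y) x ∘L
    ContinuousLinearMap.inl ℝ _ _
  isCovariantDerivativeOnUniv :=
    { add := by
        intro Y Y' x hY hY' _
        have h := D.add (σ := ofVec Y) (τ := ofVec Y') (x := x)
          ⟨hY, coDiffAt_zero x⟩ ⟨hY', coDiffAt_zero x⟩
        have e : (fun y ↦ ofVec Y y + ofVec Y' y) = ofVec (Y + Y') := by
          funext y; simp [ofVec]
        rw [e] at h
        ext X
        simp [h]
      leibniz := by
        intro Y f x hY hf _
        have e : (fun y ↦ f y • ofVec Y y) = ofVec (f • Y) := by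
          funext y; simp [ofVec]
        ext X
        have h := D.leibniz (σ := ofVec Y) (x := x) hf ⟨hY, coDiffAt_zero x⟩ (X, 0)
        rw [e] at h
        simp [h, dirDeriv, ofVec] }

/-- The `T*M`-`TM` block `∇^{T*T}` of `∇`: the covector field `∇^{T*T}_X Y`. -/
def nablaTsT (X Y : VField E M) : CoField E M := fun x ↦ (D.nabla X (ofVec Y) x).2

/-- The `TM`-`T*M` block `∇^{TT*}` of `∇`: the vector field `∇^{TT*}_X η`. -/
def nablaTTs (X : VField E M) (η : CoField E M) : VField E M := fun x ↦ (D.nabla X (ofCov η) x).1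

/-- The `T*M`-`T*M` block `∇^{T*T*}` of `∇`: the covector field `∇^{T*T*}_X η`. -/
def nablaTsTs (X : VField E M) (η : CoField E M) : CoField E M :=
  fun x ↦ (D.nabla X (ofCov η) x).2

/-- The block `V^{TT}` of `V`: the vector field `V^{TT}_ν Y`. -/
def vTT (ν : CoField E M) (Y : VField E M) : VField E M := fun x ↦ (D.vPart ν (ofVec Y) x).1

/-- The block `V^{T*T}` of `V`: the covector field `V^{T*T}_ν Y`. -/
def vTsT (ν : CoField E M) (Y : VField E M) : CoField E M := fun x ↦ (D.vPart ν (ofVec Y) x).2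

/-- The block `V^{TT*}` of `V`: the vector field `V^{TT*}_ν η`. -/
def vTTs (ν η : CoField E M) : VField E M := fun x ↦ (D.vPart ν (ofCov η) x).1

/-- The block `V^{T*T*}` of `V`: the covector field `V^{T*T*}_ν η`. -/
def vTsTs (ν η : CoField E M) : CoField E M := fun x ↦ (D.vPart ν (ofCov η) x).2

/-- Compatibility with the pairing: `ρ(a)⟨b, c⟩ = ⟨D_a b, c⟩ + ⟨b, D_a c⟩`. -/
def PairingCompatible : Prop :=
  ∀ (x : M) (a : GenTangent E x) (b c : GenField E M), GenSmoothAt b x → GenSmoothAt c x →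
    dirDeriv (fun y ↦ pairing (b y) (c y)) x a.1 =
      pairing (D.toFun b x a) (c x) + pairing (b x) (D.toFun c x a)

/-! ### `K`-torsion -/

/-- `T_∇(X, Y) = ∇_X Y - ∇_Y X - [X, Y] + H(X, Y, ·)`. -/
def torsionNabla (H : ThreeForm E M) (X Y : VField E M) : GenField E M := fun x ↦
  D.nabla X (ofVec Y) x - D.nabla Y (ofVec X) x
    - (VectorField.mlieBracket 𝓘(ℝ, E) X Y x, 0) + (0, H.toFun x (X x) (Y x))

/-- `T_V(ν, η) = V_ν η - V_η ν`. -/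
def torsionV (ν η : CoField E M) : GenField E M := fun x ↦
  D.vPart ν (ofCov η) x - D.vPart η (ofCov ν) x

/-- `T^{(1,1)K}(X, ν) = ∇_X ν - ∇^K_X ν - V_ν X`. -/
def torsionMixed (K : AffineConn E M) (X : VField E M) (ν : CoField E M) : GenField E M := fun x ↦
  D.nabla X (ofCov ν) x - (0, dualAt K ν x (X x)) - D.vPart ν (ofVec X) x

/-- The `K`-torsion `T^K_D = T_∇ + T_V + T^{(1,1)K}`, evaluated on two sections of `𝕋M`. -/
def kTorsion (K : AffineConn E M) (H : ThreeForm E M) (a b : GenField E M) : GenField E M :=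
  fun x ↦
    D.torsionNabla H (fun y ↦ (a y).1) (fun y ↦ (b y).1) x
      + D.torsionV (fun y ↦ (a y).2) (fun y ↦ (b y).2) x
      + D.torsionMixed K (fun y ↦ (a y).1) (fun y ↦ (b y).2) x
      - D.torsionMixed K (fun y ↦ (b y).1) (fun y ↦ (a y).2) x

/-- Vanishing of the `K`-torsion. -/
def KTorsionFree (K : AffineConn E M) (H : ThreeForm E M) : Prop :=
  ∀ (x : M) (a b : GenField E M), GenSmoothAt a x → GenSmoothAt b x → D.kTorsion K H a b x = 0

/-! ### `K`-curvature -/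

/-- `R_∇(X, Y)σ + V_{H(X, Y, ·)}σ`, with `R_∇(X, Y) = [∇_X, ∇_Y] - ∇_{[X, Y]}`: the part of the
curvature with two legs along `TM`, including the contribution of the three-form. -/
def curvNabla (H : ThreeForm E M) (X Y : VField E M) (σ : GenField E M) : GenField E M := fun x ↦
  D.nabla X (D.nabla Y σ) x - D.nabla Y (D.nabla X σ) x
    - D.nabla (VectorField.mlieBracket 𝓘(ℝ, E) X Y) σ x
    + D.vPart (fun y ↦ H.toFun y (X y) (Y y)) σ x

/-- `(V ∧ V)(ν, η) = [V_ν, V_η]`. -/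
def curvV (ν η : CoField E M) (σ : GenField E M) : GenField E M := fun x ↦
  D.vPart ν (D.vPart η σ) x - D.vPart η (D.vPart ν σ) x

/-- `(∇^{ΓK}_X V)_ν σ = ∇_X (V_ν σ) - V_ν (∇_X σ) - V_{∇^K_X ν} σ`: the covariant derivative of
`V ∈ Γ(TM ⊗ End 𝕋M)` with respect to `∇` and `∇^K`. -/
def nablaV (K : AffineConn E M) (X : VField E M) (ν : CoField E M) (σ : GenField E M) :
    GenField E M := fun x ↦
  D.nabla X (D.vPart ν σ) x - D.vPart ν (D.nabla X σ) x
    - D.vPart (fun y ↦ dualAt K ν y (X y)) σ x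

/-- The `K`-curvature `R^K_D(a, b)σ`. -/
def kCurv (K : AffineConn E M) (H : ThreeForm E M) (a b σ : GenField E M) : GenField E M := fun x ↦
  D.curvNabla H (fun y ↦ (a y).1) (fun y ↦ (b y).1) σ x
    + D.curvV (fun y ↦ (a y).2) (fun y ↦ (b y).2) σ x
    + D.nablaV K (fun y ↦ (a y).1) (fun y ↦ (b y).2) σ x
    - D.nablaV K (fun y ↦ (b y).1) (fun y ↦ (a y).2) σ x

/-- The tensor `γ = ∇^{T*T} - ½ H`; the component `γ_{μνρ}` is `γ(e_μ, e_ν, e_ρ)`, where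
`⟨∇^{T*T}_{e_μ} e_ρ, e_ν⟩` is the `(μ, ν, ρ)`-component of `∇^{T*T}`. -/
def gamma (H : ThreeForm E M) (X Y Z : VField E M) (x : M) : ℝ :=
  D.nablaTsT X Z x (Y x) - (1 / 2 : ℝ) * H.toFun x (X x) (Y x) (Z x)

end GenConn

/-! ### Local frames and components -/

variable (E M) in
/-- A smooth local frame `e_μ` of `TM` over an open set `U`, with its dual coframe `e^μ`. -/
structure Frame (ι : Type*) [DecidableEq ι] where
  /-- The domain. -/
  U : Set M
  isOpen_U : IsOpen U
  /-- The frame `e_μ`. -/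
  e : ι → VField E M
  /-- The dual coframe `e^μ`. -/
  θ : ι → CoField E M
  smooth_e (μ : ι) {x : M} (hx : x ∈ U) : VSmoothAt (e μ) x
  smooth_θ (μ : ι) {x : M} (hx : x ∈ U) : CoSmoothAt (θ μ) x
  dual (μ ν : ι) {x : M} (hx : x ∈ U) : θ μ x (e ν x) = if μ = ν then 1 else 0
  span {x : M} (hx : x ∈ U) : Submodule.span ℝ (Set.range fun μ ↦ e μ x) = ⊤

namespace Frame

variable {ι : Type*} [DecidableEq ι] (F : Frame E M ι)

/-- A frame is holonomic (a coordinate frame near each point) iff its members commute. -/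
def Holonomic : Prop :=
  ∀ μ ν, ∀ x ∈ F.U, VectorField.mlieBracket 𝓘(ℝ, E) (F.e μ) (F.e ν) x = 0

/-- The local basis `E_α = (e_μ, e^μ)` of `𝕋M`. -/
def Elow : ι ⊕ ι → GenField E M
  | .inl μ => ofVec (F.e μ)
  | .inr μ => ofCov (F.θ μ)

/-- The dual basis `E^α = (e^μ, e_μ)` of `𝕋M` with respect to the canonical pairing. -/
def Eup (α : ι ⊕ ι) : GenField E M := F.Elow α.swap

variable [Fintype ι]

/-- The matrix `g_{μν}` at `x`. -/
def gMat (g : Metric E M) (x : M) : Matrix ι ι ℝ :=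
  Matrix.of fun μ ν ↦ g.inner x (F.e μ x) (F.e ν x)

/-- The matrix `B_{μν}` at `x`. -/
def bMat (B : TwoForm E M) (x : M) : Matrix ι ι ℝ :=
  Matrix.of fun μ ν ↦ B.toFun x (F.e μ x) (F.e ν x)

/-- The matrix of the generalized metric `G` defined by `g` and `B`: the entry `(α, β)` is
`G(E_α, E_β)`. -/
def genMetric (g : Metric E M) (B : TwoForm E M) (x : M) : Matrix (ι ⊕ ι) (ι ⊕ ι) ℝ :=
  Matrix.fromBlocks
    (F.gMat g x - F.bMat B x * (F.gMat g x)⁻¹ * F.bMat B x) (F.bMat B x * (F.gMat g x)⁻¹)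
    (-((F.gMat g x)⁻¹ * F.bMat B x)) (F.gMat g x)⁻¹

/-- `G_{μν}`. -/
def Gdown (g : Metric E M) (B : TwoForm E M) (x : M) (μ ν : ι) : ℝ :=
  F.genMetric g B x (.inl μ) (.inl ν)

/-- `G^{μν}`. -/
def Gup (g : Metric E M) (B : TwoForm E M) (x : M) (μ ν : ι) : ℝ :=
  F.genMetric g B x (.inr μ) (.inr ν)

variable (D : GenConn E M)

/-- `Ric^K_{αβ} = ⟨E^γ, R^K_D(E_γ, E_α) E_β⟩`. -/
def ricK (K : AffineConn E M) (H : ThreeForm E M) (x : M) (α β : ι ⊕ ι) : ℝ :=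
  ∑ κ, pairing (F.Eup κ x) (D.kCurv K H (F.Elow κ) (F.Elow α) (F.Elow β) x)

/-- `Scal^K = G^{αβ} Ric^K_{αβ}`, with `G^{αβ} = G(E^α, E^β)`. -/
def scalK (K : AffineConn E M) (H : ThreeForm E M) (g : Metric E M) (B : TwoForm E M) (x : M) :
    ℝ :=
  ∑ α, ∑ β, F.genMetric g B x α.swap β.swap * F.ricK D K H x α β

/-- The coefficient `Γ_μ{}^ν{}_ρ` of `∇^{TT}`, i.e. `⟨e^ν, ∇^{TT}_{e_μ} e_ρ⟩`. -/
def Γ (μ ν ρ : ι) (x : M) : ℝ := F.θ ν x (D.nablaTT (F.e ρ) x (F.e μ x))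

/-- The component `V^{μνρ}` of `V^{TT*}`, i.e. `⟨e^ν, V^{TT*}_{e^μ} e^ρ⟩`. -/
def Vup (μ ν ρ : ι) (x : M) : ℝ := F.θ ν x (D.vTTs (F.θ μ) (F.θ ρ) x)

/-- The component `V^μ{}_{νρ}` of `V^{T*T}`, i.e. `⟨V^{T*T}_{e^μ} e_ρ, e_ν⟩`. -/
def Vdown (μ ν ρ : ι) (x : M) : ℝ := D.vTsT (F.θ μ) (F.e ρ) x (F.e ν x)

/-- `∇_κ V^{μνρ}`: components of the covariant derivative of `V^{TT*}` with respect to `∇^{TT}`. -/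
def dVup (κ μ ν ρ : ι) (x : M) : ℝ :=
  dirDeriv (F.Vup D μ ν ρ) x (F.e κ x)
    + ∑ l, F.Γ D κ μ l x * F.Vup D l ν ρ x
    + ∑ l, F.Γ D κ ν l x * F.Vup D μ l ρ x
    + ∑ l, F.Γ D κ ρ l x * F.Vup D μ ν l x

/-- `∇_κ V^μ{}_{νρ}`: components of the covariant derivative of `V^{T*T}` with respect to
`∇^{TT}`. -/
def dVdown (κ μ ν ρ : ι) (x : M) : ℝ :=
  dirDeriv (F.Vdown D μ ν ρ) x (F.e κ x)
    + ∑ l, F.Γ D κ μ l x * F.Vdown D l ν ρ x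
    - ∑ l, F.Γ D κ l ν x * F.Vdown D μ l ρ x
    - ∑ l, F.Γ D κ l ρ x * F.Vdown D μ ν l x

/-- `R^{∇^{TT}}(X, Y)Z`, the curvature of the affine connection `∇^{TT}`. -/
def curvTT (X Y Z : VField E M) : VField E M := fun x ↦
  D.nablaTT (fun y ↦ D.nablaTT Z y (Y y)) x (X x)
    - D.nablaTT (fun y ↦ D.nablaTT Z y (X y)) x (Y x)
    - D.nablaTT Z x (VectorField.mlieBracket 𝓘(ℝ, E) X Y x)

/-- `Scal(g, ∇^{TT}) = g^{μν} Ric_{μν}`, with `Ric_{μν} = ⟨e^ρ, R(e_ρ, e_μ) e_ν⟩` the Ricci tensor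
of `∇^{TT}`. -/
def scalTT (g : Metric E M) (x : M) : ℝ :=
  ∑ μ, ∑ ν, (F.gMat g x)⁻¹ μ ν * ∑ ρ, F.θ ρ x (curvTT D (F.e ρ) (F.e μ) (F.e ν) x)

/-- The combination
`∂_ρ Γ_μ{}^ρ{}_ν - ∂_μ Γ_ρ{}^ρ{}_ν + Γ_ρ{}^ρ{}_σ Γ_μ{}^σ{}_ν - Γ_μ{}^ρ{}_σ Γ_ρ{}^σ{}_ν`
contracted with `G^{μν}`. -/
def scalCoord (g : Metric E M) (B : TwoForm E M) (x : M) : ℝ :=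
  ∑ μ, ∑ ν, F.Gup g B x μ ν *
    (∑ ρ, dirDeriv (F.Γ D μ ρ ν) x (F.e ρ x)
      - ∑ ρ, dirDeriv (F.Γ D ρ ρ ν) x (F.e μ x)
      + ∑ ρ, ∑ σ, F.Γ D ρ ρ σ x * F.Γ D μ σ ν x
      - ∑ ρ, ∑ σ, F.Γ D μ ρ σ x * F.Γ D ρ σ ν x)

end Frame

end Sections

end CourantGeom

end

open CourantGeom

/-!
Write `D = ∇ + V` in blocks. The torsion equation and the compatibility with the pairing, evaluated on
vector fields and on covector fields separately, are symmetry statements about these blocks, and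
conflicting symmetries make most of the blocks vanish.

* On two vector fields, the torsion says that `∇^{TT}` is torsion-free and that the part of `∇^{T*T}`
  which is antisymmetric in its two arguments is given by `H`. The mixed part of the torsion expresses
  `∇^K` by `D` and identifies `∇^{TT*}_X ν` with `V^{TT}_ν X`.
* `V^{T*T*}_ξ η` is symmetric in `ξ` and `η`, because the torsion vanishes on covectors. By
  compatibility `⟨V_ξ η, Y⟩ = -⟨η, V_ξ Y⟩ = -⟨η, ∇_Y ξ⟩`, which is antisymmetric in `ξ` and `η`. So
  `V^{T*T*}`, `V^{TT}` and `∇^{TT*}` vanish (`snd_vertical_ofCov`, `fst_vertical_ofVec`,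
  `fst_horizontal_ofCov`). The block `V^{TT*}` is symmetric in its first and third entries and
  antisymmetric in the last two, so it vanishes as well (`fst_vertical_ofCov`). Compatibility makes
  `∇^{T*T*}` the dual of `∇^{TT}` (`snd_horizontal_ofCov`).

Hence `D` is block triangular (`fst_toFun`, `snd_toFun`), and so is its curvature: the `TM`-component of
`R^K_D` is the curvature of `∇^{TT}` (`fst_kCurv`), and its `T*M`-component, with a covector in the
first argument, is the derivative `-∇^K V` (`snd_kCurv_ofCov`). In a local frame the `K`-Ricci tensor
therefore has only its `TM`-`TM` block. There `∇^K` is eliminated by means of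
`∇^K_X ν = ∇^{T*T*}_X ν - V^{T*T}_ν X`, which produces the covariant derivative of `V^{T*T}` with
respect to `∇^{TT}` and the quadratic term in `V^{T*T}` (`Frame.snd_nablaV_frame`).
-/

noncomputable section

namespace CourantGeom

section

variable {E : Type*} [NormedAddCommGroup E] [NormedSpace ℝ E]
  {M : Type*} [TopologicalSpace M] [ChartedSpace E M]

/-! ### Smooth sections and directional derivatives -/

lemma dirDeriv_congr {f g : M → ℝ} {x : M} (h : f =ᶠ[𝓝 x] g) (v : TangentSpace 𝓘(ℝ, E) x) :
    dirDeriv f x v = dirDeriv g x v := by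
  have := h.mfderiv_eq (I := 𝓘(ℝ, E)) (I' := 𝓘(ℝ, ℝ))
  simp only [dirDeriv, mvfderiv, this]
  rfl

lemma dirDeriv_const (c : ℝ) (x : M) (v : TangentSpace 𝓘(ℝ, E) x) :
    dirDeriv (fun _ ↦ c) x v = 0 := by
  simp [dirDeriv, mvfderiv_const]

@[simp] lemma dirDeriv_zero_right (f : M → ℝ) (x : M) :
    dirDeriv (E := E) f x 0 = 0 := by
  simp [dirDeriv]

variable [IsManifold 𝓘(ℝ, E) ∞ M]

lemma VSmoothAt.vDiffAt {X : VField E M} {x : M} (h : VSmoothAt X x) : VDiffAt X x :=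
  ContMDiffAt.mdifferentiableAt h (by simp)

lemma CoSmoothAt.coDiffAt {ξ : CoField E M} {x : M} (h : CoSmoothAt ξ x) : CoDiffAt ξ x :=
  ContMDiffAt.mdifferentiableAt h (by simp)

lemma GenSmoothAt.genDiffAt {a : GenField E M} {x : M} (h : GenSmoothAt a x) : GenDiffAt a x :=
  ⟨h.1.vDiffAt, h.2.coDiffAt⟩

lemma vSmoothAt_zero (x : M) : VSmoothAt (fun _ ↦ 0 : VField E M) x :=
  Bundle.contMDiff_zeroSection ℝ (fun z : M ↦ TangentSpace 𝓘(ℝ, E) z) x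

lemma coSmoothAt_zero (x : M) : CoSmoothAt (fun _ ↦ 0 : CoField E M) x :=
  Bundle.contMDiff_zeroSection ℝ (fun z : M ↦ (TangentSpace 𝓘(ℝ, E) z →L[ℝ] ℝ)) x

lemma VSmoothAt.ofVec {X : VField E M} {x : M} (h : VSmoothAt X x) : GenSmoothAt (ofVec X) x :=
  ⟨h, coSmoothAt_zero x⟩

lemma CoSmoothAt.ofCov {ξ : CoField E M} {x : M} (h : CoSmoothAt ξ x) :
    GenSmoothAt (ofCov ξ) x :=
  ⟨vSmoothAt_zero x, h⟩

/-- Every tangent vector is the value of a vector field that is smooth at its base point. -/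
lemma exists_vSmoothAt {x : M} (v : TangentSpace 𝓘(ℝ, E) x) :
    ∃ X : VField E M, VSmoothAt X x ∧ X x = v :=
  ⟨FiberBundle.extend E v, FiberBundle.contMDiffAt_extend 𝓘(ℝ, E) E v, by simp⟩

lemma exists_coSmoothAt {x : M} (ξ : TangentSpace 𝓘(ℝ, E) x →L[ℝ] ℝ) :
    ∃ X : CoField E M, CoSmoothAt X x ∧ X x = ξ :=
  ⟨FiberBundle.extend (E →L[ℝ] ℝ) (E := fun z : M ↦ (TangentSpace 𝓘(ℝ, E) z →L[ℝ] ℝ)) ξ,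
    FiberBundle.contMDiffAt_extend 𝓘(ℝ, E) (E →L[ℝ] ℝ)
      (V := fun z : M ↦ (TangentSpace 𝓘(ℝ, E) z →L[ℝ] ℝ)) ξ, by simp⟩

lemma VDiffAt.congr {Y Z : VField E M} {x : M} (hY : VDiffAt Y x) (h : ∀ᶠ y in 𝓝 x, Z y = Y y) :
    VDiffAt Z x :=
  MDifferentiableAt.congr_of_eventuallyEq hY (h.mono fun y hy ↦ by simp only [hy])

lemma CoDiffAt.congr {Y Z : CoField E M} {x : M} (hY : CoDiffAt Y x) (h : ∀ᶠ y in 𝓝 x, Z y = Y y) :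
    CoDiffAt Z x :=
  MDifferentiableAt.congr_of_eventuallyEq hY (h.mono fun y hy ↦ by simp only [hy])

lemma affineConn_congr (cov : AffineConn E M) {Y Z : VField E M} {x : M} (hY : VDiffAt Y x)
    (h : ∀ᶠ y in 𝓝 x, Y y = Z y) : cov Y x = cov Z x :=
  cov.isCovariantDerivativeOnUniv.congr_of_eventuallyEq hY
    (hY.congr (h.mono fun _ ↦ Eq.symm)) (by simp) h

lemma affineConn_eq_zero (cov : AffineConn E M) {Y : VField E M} {x : M} (hY : VDiffAt Y x)
    (h : ∀ᶠ y in 𝓝 x, Y y = 0) : cov Y x = 0 := by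
  rw [affineConn_congr cov hY h]
  exact congrFun cov.zero x

lemma eq_zero_of_forall_coSmoothAt {x : M} {v : TangentSpace 𝓘(ℝ, E) x}
    (h : ∀ ξ : CoField E M, CoSmoothAt ξ x → ξ x v = 0) : v = 0 := by
  refine SeparatingDual.eq_zero_of_forall_dual_eq_zero (R := ℝ) (V := E) fun f ↦ ?_
  obtain ⟨ξ, hξ, rfl⟩ := exists_coSmoothAt (x := x) f
  exact h ξ hξ

/-! ### Generalized connections: locality and tensoriality -/

namespace GenConn

variable (D : GenConn E M)

lemma toFun_zero_apply (x : M) (a : GenTangent E x) : D.toFun (fun _ ↦ 0) x a = 0 := by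
  have h := D.leibniz (f := fun _ ↦ 0) (σ := fun _ ↦ 0) (x := x) mdifferentiableAt_const
    ⟨vDiffAt_zero x, coDiffAt_zero x⟩ a
  simpa using h

lemma toFun_apply_zero (σ : GenField E M) (x : M) : D.toFun σ x (0, 0) = 0 :=
  (D.toFun σ x).map_zero

lemma nabla_zero (σ : GenField E M) : D.nabla (fun _ ↦ 0) σ = fun _ ↦ 0 :=
  funext fun x ↦ D.toFun_apply_zero σ x

lemma toFun_ofVec_zero_apply (x : M) (a : GenTangent E x) :
    D.toFun (ofVec fun _ ↦ 0) x a = 0 := D.toFun_zero_apply x a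

lemma toFun_ofCov_zero_apply (x : M) (a : GenTangent E x) :
    D.toFun (ofCov fun _ ↦ 0) x a = 0 := D.toFun_zero_apply x a

lemma toFun_eq_add {σ : GenField E M} {x : M} (h : GenDiffAt σ x) :
    D.toFun σ x = D.toFun (ofVec fun y ↦ (σ y).1) x + D.toFun (ofCov fun y ↦ (σ y).2) x := by
  have := D.add (σ := ofVec fun y ↦ (σ y).1) (τ := ofCov fun y ↦ (σ y).2) (x := x)
    ⟨h.1, coDiffAt_zero x⟩ ⟨vDiffAt_zero x, h.2⟩
  rw [← this]
  congr 1
  funext y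
  simp [ofVec, ofCov]

lemma toFun_eq_horizontal_add_vertical (σ : GenField E M) (x : M) (a : GenTangent E x) :
    D.toFun σ x a = D.toFun σ x (a.1, 0) + D.toFun σ x (0, a.2) := by
  have h := (D.toFun σ x).map_add (a.1, 0) (0, a.2)
  rwa [Prod.mk_add_mk, add_zero, zero_add] at h

/-- The operator `Y ↦ V_ξ Y` is tensorial in the vector field `Y`. -/
lemma vertical_tensorial {x : M} (ξ : TangentSpace 𝓘(ℝ, E) x →L[ℝ] ℝ) :
    TensorialAt 𝓘(ℝ, E) E (fun Y : VField E M ↦ D.toFun (ofVec Y) x (0, ξ)) x where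
  smul := by
    intro f Y hf hY
    have h := D.leibniz (σ := ofVec Y) (x := x) hf ⟨hY, coDiffAt_zero x⟩ (0, ξ)
    have e : (fun y ↦ f y • ofVec Y y) = ofVec (f • Y) := by
      funext y; simp [ofVec]
    rw [e] at h
    simp [h]
  add := by
    intro Y Y' hY hY'
    have h := D.add (σ := ofVec Y) (τ := ofVec Y') (x := x)
      ⟨hY, coDiffAt_zero x⟩ ⟨hY', coDiffAt_zero x⟩
    have e : (fun y ↦ ofVec Y y + ofVec Y' y) = ofVec (Y + Y') := by
      funext y; simp [ofVec]
    rw [e] at h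
    simp [h]

/-- Generalized connections are local operators: `D_a Y` at `x` vanishes if `Y` vanishes near `x`. -/
lemma toFun_ofVec_eq_zero {Y : VField E M} {x : M} (hY : VDiffAt Y x)
    (h : ∀ᶠ y in 𝓝 x, Y y = 0) (a : GenTangent E x) : D.toFun (ofVec Y) x a = 0 := by
  classical
  -- the discontinuous factor `f` is locally zero at `x`, so the Leibniz rule applies to `Y = f • Y`
  set f : M → ℝ := fun y ↦ if Y y = 0 then 0 else 1
  have hf0 : f =ᶠ[𝓝 x] fun _ ↦ 0 := by
    filter_upwards [h] with y hy
    simp [f, hy]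
  have hf : MDifferentiableAt 𝓘(ℝ, E) 𝓘(ℝ, ℝ) f x :=
    mdifferentiableAt_const.congr_of_eventuallyEq hf0
  have e : (fun y ↦ f y • ofVec Y y) = ofVec Y := by
    funext y
    by_cases hy : Y y = 0
    · simp [f, ofVec, hy]
      rfl
    · simp [f, ofVec, hy]
  have := D.leibniz (σ := ofVec Y) (x := x) hf ⟨hY, coDiffAt_zero x⟩ a
  rw [e, hf0.eq_of_nhds, dirDeriv_congr hf0, dirDeriv_const] at this
  simpa using this

variable [FiniteDimensional ℝ E]

lemma toFun_ofVec_vertical_congr {Y Z : VField E M} {x : M} (hY : VDiffAt Y x)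
    (hZ : VDiffAt Z x) (h : Y x = Z x) (ξ : TangentSpace 𝓘(ℝ, E) x →L[ℝ] ℝ) :
    D.toFun (ofVec Y) x (0, ξ) = D.toFun (ofVec Z) x (0, ξ) :=
  (D.vertical_tensorial ξ).pointwise hY hZ h

end GenConn

variable [FiniteDimensional ℝ E]

lemma dualAt_zero_left (cov : AffineConn E M) (x : M) (v : TangentSpace 𝓘(ℝ, E) x) :
    dualAt cov (fun _ ↦ 0) x v = 0 := by
  ext w
  obtain ⟨W, hW, rfl⟩ := exists_vSmoothAt w
  rw [dualAt_apply cov (coDiffAt_zero x) hW.vDiffAt]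
  simp [dirDeriv_const]

lemma dualAt_zero_right (cov : AffineConn E M) {ν : CoField E M} {x : M} (hν : CoDiffAt ν x) :
    dualAt cov ν x 0 = 0 := by
  ext w
  obtain ⟨W, hW, rfl⟩ := exists_vSmoothAt w
  rw [dualAt_apply cov hν hW.vDiffAt]
  simp

lemma dualAt_congr (cov : AffineConn E M) {ν η : CoField E M} {x : M} (hν : CoDiffAt ν x)
    (h : ∀ᶠ y in 𝓝 x, ν y = η y) (v : TangentSpace 𝓘(ℝ, E) x) :
    dualAt cov ν x v = dualAt cov η x v := by
  ext w
  obtain ⟨W, hW, rfl⟩ := exists_vSmoothAt w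
  rw [dualAt_apply cov hν hW.vDiffAt,
    dualAt_apply cov (hν.congr (h.mono fun _ ↦ Eq.symm)) hW.vDiffAt, h.self_of_nhds,
    dirDeriv_congr (g := fun y ↦ η y (W y)) (h.mono fun y hy ↦ by simp only [hy])]

end

section

variable {E : Type*} [NormedAddCommGroup E] [NormedSpace ℝ E]
  {M : Type*} [TopologicalSpace M] [ChartedSpace E M]
  [IsManifold 𝓘(ℝ, E) ∞ M]

/-! ### The blocks of a torsion-free compatible generalized connection -/

lemma ThreeForm.toFun_zero_left (H : ThreeForm E M) (x : M) : H.toFun x 0 = 0 :=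
  (H.toFun x).map_zero

lemma ThreeForm.swap_left (H : ThreeForm E M) (x : M) (u v w : TangentSpace 𝓘(ℝ, E) x) :
    H.toFun x u v w = -H.toFun x v u w := by
  have h := H.alt_left x (u + v) w
  rw [(H.toFun x).map_add, add_apply, add_apply, (H.toFun x u).map_add, (H.toFun x v).map_add,
    add_apply, add_apply, H.alt_left, H.alt_left] at h
  linarith

lemma ThreeForm.swap_right (H : ThreeForm E M) (x : M) (u v w : TangentSpace 𝓘(ℝ, E) x) :
    H.toFun x u v w = -H.toFun x u w v := by
  have h := H.alt_right x u (v + w)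
  simp only [map_add, add_apply, H.alt_right] at h
  linarith

namespace GenConn

variable {D : GenConn E M}

lemma PairingCompatible.vec_vec (hP : D.PairingCompatible) {x : M} {Y Z : VField E M}
    (hY : VSmoothAt Y x) (hZ : VSmoothAt Z x) (a : GenTangent E x) :
    (D.toFun (ofVec Y) x a).2 (Z x) = -(D.toFun (ofVec Z) x a).2 (Y x) := by
  have h := hP x a (ofVec Y) (ofVec Z) hY.ofVec hZ.ofVec
  simp only [pairing, ofVec, zero_apply, add_zero, zero_add,
    dirDeriv_const] at h
  exact eq_neg_of_add_eq_zero_left h.symm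

lemma PairingCompatible.cov_cov (hP : D.PairingCompatible) {x : M} {η ζ : CoField E M}
    (hη : CoSmoothAt η x) (hζ : CoSmoothAt ζ x) (a : GenTangent E x) :
    ζ x (D.toFun (ofCov η) x a).1 = -η x (D.toFun (ofCov ζ) x a).1 := by
  have h := hP x a (ofCov η) (ofCov ζ) hη.ofCov hζ.ofCov
  simp only [pairing, ofCov, map_zero, add_zero, zero_add,
    dirDeriv_const] at h
  exact eq_neg_of_add_eq_zero_left h.symm

lemma PairingCompatible.vec_cov (hP : D.PairingCompatible) {x : M} {Y : VField E M}
    {η : CoField E M} (hY : VSmoothAt Y x) (hη : CoSmoothAt η x) (a : GenTangent E x) :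
    dirDeriv (fun y ↦ η y (Y y)) x a.1 =
      η x (D.toFun (ofVec Y) x a).1 + (D.toFun (ofCov η) x a).2 (Y x) := by
  have h := hP x a (ofVec Y) (ofCov η) hY.ofVec hη.ofCov
  simpa only [pairing, ofVec, ofCov, zero_apply, map_zero, add_zero,
    zero_add] using h

lemma gamma_swap_right {H : ThreeForm E M} (hP : D.PairingCompatible) {x : M} {X Y Z : VField E M}
    (hY : VSmoothAt Y x) (hZ : VSmoothAt Z x) : D.gamma H X Y Z x = -D.gamma H X Z Y x := by
  have h : D.nablaTsT X Z x (Y x) = -D.nablaTsT X Y x (Z x) := hP.vec_vec hZ hY (X x, 0)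
  have h1 := H.swap_right x (X x) (Y x) (Z x)
  simp only [gamma]
  linarith

variable [FiniteDimensional ℝ E] {K : AffineConn E M} {H : ThreeForm E M}

/-- The torsion equation on two vector fields. -/
lemma KTorsionFree.horizontal (hT : D.KTorsionFree K H) {x : M} {X Y : VField E M}
    (hX : VSmoothAt X x) (hY : VSmoothAt Y x) :
    D.nabla X (ofVec Y) x - D.nabla Y (ofVec X) x
      - (VectorField.mlieBracket 𝓘(ℝ, E) X Y x, 0) + (0, H.toFun x (X x) (Y x)) = 0 := by
  have h : D.torsionNabla H X Y x + D.torsionV (fun _ ↦ 0) (fun _ ↦ 0) x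
      + D.torsionMixed K X (fun _ ↦ 0) x - D.torsionMixed K Y (fun _ ↦ 0) x = 0 :=
    hT x (ofVec X) (ofVec Y) hX.ofVec hY.ofVec
  have hm : ∀ Z : VField E M, D.torsionMixed K Z (fun _ ↦ 0) x = 0 := fun Z ↦ by
    simp only [torsionMixed, nabla, vPart, toFun_ofCov_zero_apply, dualAt_zero_left]
    simp [toFun_apply_zero]
  rw [hm, hm] at h
  simpa [torsionV, torsionNabla] using h

/-- The torsion equation on two covector fields. -/
lemma KTorsionFree.vertical (hT : D.KTorsionFree K H) {x : M} {ξ η : CoField E M}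
    (hξ : CoSmoothAt ξ x) (hη : CoSmoothAt η x) :
    D.vPart ξ (ofCov η) x = D.vPart η (ofCov ξ) x := by
  have h : D.torsionNabla H (fun _ ↦ 0) (fun _ ↦ 0) x + D.torsionV ξ η x
      + D.torsionMixed K (fun _ ↦ 0) η x - D.torsionMixed K (fun _ ↦ 0) ξ x = 0 :=
    hT x (ofCov ξ) (ofCov η) hξ.ofCov hη.ofCov
  have hm : ∀ ζ : CoField E M, CoSmoothAt ζ x → D.torsionMixed K (fun _ ↦ 0) ζ x = 0 :=
    fun ζ hζ ↦ by
      simp only [torsionMixed, nabla, vPart, toFun_ofVec_zero_apply,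
        dualAt_zero_right K hζ.coDiffAt]
      simp [toFun_apply_zero]
  have hn : D.torsionNabla H (fun _ ↦ 0) (fun _ ↦ 0) x = 0 := by
    have e : VectorField.mlieBracket 𝓘(ℝ, E) (fun _ ↦ 0 : VField E M) (fun _ ↦ 0) x = 0 :=
      congrFun VectorField.mlieBracket_zero_left x
    simp [torsionNabla, e, nabla, toFun_apply_zero, ThreeForm.toFun_zero_left]
  rw [hm ξ hξ, hm η hη, hn] at h
  simpa [torsionV, sub_eq_zero] using h

/-- The torsion equation on a vector field and a covector field. -/
lemma KTorsionFree.mixed (hT : D.KTorsionFree K H) {x : M} {X : VField E M} {ν : CoField E M}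
    (hX : VSmoothAt X x) (hν : CoSmoothAt ν x) :
    D.nabla X (ofCov ν) x - (0, dualAt K ν x (X x)) - D.vPart ν (ofVec X) x = 0 := by
  have h : D.torsionNabla H X (fun _ ↦ 0) x + D.torsionV (fun _ ↦ 0) ν x
      + D.torsionMixed K X ν x - D.torsionMixed K (fun _ ↦ 0) (fun _ ↦ 0) x = 0 :=
    hT x (ofVec X) (ofCov ν) hX.ofVec hν.ofCov
  have hm : D.torsionMixed K (fun _ ↦ 0) (fun _ ↦ 0) x = 0 := by
    simp only [torsionMixed, nabla, vPart, toFun_ofVec_zero_apply, toFun_ofCov_zero_apply,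
        dualAt_zero_left]
    simp
  have hn : D.torsionNabla H X (fun _ ↦ 0) x = 0 := by
    have e : VectorField.mlieBracket 𝓘(ℝ, E) X (fun _ ↦ 0 : VField E M) x = 0 :=
      congrFun VectorField.mlieBracket_zero_right x
    simp only [torsionNabla, nabla, toFun_ofVec_zero_apply, e]
    simp [toFun_apply_zero]
  have hv : D.torsionV (fun _ ↦ 0) ν x = 0 := by
    simp only [torsionV, vPart, toFun_ofCov_zero_apply]
    simp [toFun_apply_zero]
  rw [hm, hn, hv] at h
  simpa [torsionMixed] using h

lemma KTorsionFree.nablaTT_sub (hT : D.KTorsionFree K H) {x : M} {X Y : VField E M}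
    (hX : VSmoothAt X x) (hY : VSmoothAt Y x) :
    D.nablaTT Y x (X x) - D.nablaTT X x (Y x) = VectorField.mlieBracket 𝓘(ℝ, E) X Y x := by
  have h := congrArg Prod.fst (hT.horizontal hX hY)
  simp only [Prod.fst_add, Prod.fst_sub, add_zero, Prod.fst_zero] at h
  exact sub_eq_zero.1 h

lemma KTorsionFree.torsion_nablaTT (hT : D.KTorsionFree K H) : D.nablaTT.torsion = 0 := by
  ext x u v
  rw [CovariantDerivative.torsion_apply_eq_extend,
    hT.nablaTT_sub (FiberBundle.contMDiffAt_extend 𝓘(ℝ, E) E u)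
      (FiberBundle.contMDiffAt_extend 𝓘(ℝ, E) E v), sub_self]
  rfl

lemma KTorsionFree.nablaTsT_sub (hT : D.KTorsionFree K H) {x : M} {X Y : VField E M}
    (hX : VSmoothAt X x) (hY : VSmoothAt Y x) :
    D.nablaTsT X Y x - D.nablaTsT Y X x + H.toFun x (X x) (Y x) = 0 := by
  have h := congrArg Prod.snd (hT.horizontal hX hY)
  simp only [Prod.snd_add, Prod.snd_sub, sub_zero, Prod.snd_zero] at h
  exact h

lemma KTorsionFree.nablaTTs_eq (hT : D.KTorsionFree K H) {x : M} {X : VField E M}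
    {ν : CoField E M} (hX : VSmoothAt X x) (hν : CoSmoothAt ν x) :
    D.nablaTTs X ν x = D.vTT ν X x := by
  have h := congrArg Prod.fst (hT.mixed hX hν)
  simp only [Prod.fst_sub, sub_zero, Prod.fst_zero] at h
  exact sub_eq_zero.1 h

lemma KTorsionFree.dualAt_eq (hT : D.KTorsionFree K H) {x : M} {X : VField E M}
    {ν : CoField E M} (hX : VSmoothAt X x) (hν : CoSmoothAt ν x) :
    dualAt K ν x (X x) = D.nablaTsTs X ν x - D.vTsT ν X x := by
  have h := congrArg Prod.snd (hT.mixed hX hν)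
  simp only [Prod.snd_sub, Prod.snd_zero] at h
  have h' : D.nablaTsTs X ν x - dualAt K ν x (X x) - D.vTsT ν X x = 0 := h
  rw [sub_right_comm, sub_eq_zero] at h'
  exact h'.symm

/-- The `T*M`-`T*M` block of `V` vanishes: `⟨V_ξ η, Y⟩` is symmetric in `ξ` and `η` because the
torsion vanishes on covectors, and it is antisymmetric because it equals `-⟨∇_Y ξ, η⟩` by the mixed
part of the torsion. -/
lemma snd_vertical_ofCov (hT : D.KTorsionFree K H) (hP : D.PairingCompatible) {x : M}
    {η : CoField E M} (hη : CoSmoothAt η x) (ξ : TangentSpace 𝓘(ℝ, E) x →L[ℝ] ℝ) :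
    (D.toFun (ofCov η) x (0, ξ)).2 = 0 := by
  obtain ⟨ξ, hξ, rfl⟩ := exists_coSmoothAt ξ
  ext w
  obtain ⟨Y, hY, rfl⟩ := exists_vSmoothAt w
  have key : ∀ {α β : CoField E M}, CoSmoothAt α x → CoSmoothAt β x →
      (D.toFun (ofCov β) x (0, α x)).2 (Y x) = -β x (D.toFun (ofCov α) x (Y x, 0)).1 := by
    intro α β hα hβ
    have h1 := hP.vec_cov hY hβ (0, α x)
    have h2 : (D.toFun (ofCov α) x (Y x, 0)).1 = (D.toFun (ofVec Y) x (0, α x)).1 :=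
      hT.nablaTTs_eq hY hα
    rw [dirDeriv_zero_right] at h1
    rw [h2]
    linarith
  have h1 := key hξ hη
  have h2 := key hη hξ
  have h3 := hP.cov_cov hξ hη (Y x, 0)
  have h4 : D.toFun (ofCov η) x (0, ξ x) = D.toFun (ofCov ξ) x (0, η x) := hT.vertical hξ hη
  rw [← h4] at h2
  simp only [zero_apply]
  linarith

/-- `V^{TT}` vanishes, being minus the transpose of `V^{T*T*}`. -/
lemma fst_vertical_ofVec (hT : D.KTorsionFree K H) (hP : D.PairingCompatible) {x : M}
    {Y : VField E M} (hY : VSmoothAt Y x) (ξ : TangentSpace 𝓘(ℝ, E) x →L[ℝ] ℝ) :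
    (D.toFun (ofVec Y) x (0, ξ)).1 = 0 := by
  refine eq_zero_of_forall_coSmoothAt fun η hη ↦ ?_
  have h := hP.vec_cov hY hη (0, ξ)
  rw [dirDeriv_zero_right, snd_vertical_ofCov hT hP hη] at h
  simpa using h.symm

/-- `∇^{TT*}` vanishes, since the mixed part of the torsion identifies it with `V^{TT}`. -/
lemma fst_horizontal_ofCov (hT : D.KTorsionFree K H) (hP : D.PairingCompatible) {x : M}
    {ν : CoField E M} (hν : CoSmoothAt ν x) (v : TangentSpace 𝓘(ℝ, E) x) :
    (D.toFun (ofCov ν) x (v, 0)).1 = 0 := by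
  obtain ⟨X, hX, rfl⟩ := exists_vSmoothAt v
  exact (hT.nablaTTs_eq hX hν).trans (fst_vertical_ofVec hT hP hX (ν x))

/-- The block `V^{TT*}` vanishes, as a tensor symmetric in two and antisymmetric in two of its
three entries. -/
lemma fst_vertical_ofCov (hT : D.KTorsionFree K H) (hP : D.PairingCompatible) {x : M}
    {η : CoField E M} (hη : CoSmoothAt η x) (ξ : TangentSpace 𝓘(ℝ, E) x →L[ℝ] ℝ) :
    (D.toFun (ofCov η) x (0, ξ)).1 = 0 := by
  obtain ⟨ξ, hξ, rfl⟩ := exists_coSmoothAt ξ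
  refine eq_zero_of_forall_coSmoothAt fun ζ hζ ↦ ?_
  have sym : ∀ {α β : CoField E M}, CoSmoothAt α x → CoSmoothAt β x →
      (D.toFun (ofCov β) x (0, α x)).1 = (D.toFun (ofCov α) x (0, β x)).1 :=
    fun hα hβ ↦ congrArg Prod.fst (hT.vertical hα hβ)
  have alt : ∀ {α β : CoField E M}, CoSmoothAt α x → CoSmoothAt β x → ∀ a,
      β x (D.toFun (ofCov α) x (0, a)).1 = -α x (D.toFun (ofCov β) x (0, a)).1 :=
    fun hα hβ a ↦ hP.cov_cov hα hβ _
  have e1 := alt hη hζ (ξ x)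
  have e2 := alt hζ hξ (η x)
  have e3 := alt hξ hη (ζ x)
  rw [sym hξ hζ] at e1
  rw [sym hη hξ] at e2
  rw [sym hζ hη] at e3
  linarith

/-- Compatibility with the pairing makes `∇^{T*T*}` the dual connection of `∇^{TT}`. -/
lemma snd_horizontal_ofCov (hP : D.PairingCompatible) {x : M} {ν : CoField E M}
    (hν : CoSmoothAt ν x) (v : TangentSpace 𝓘(ℝ, E) x) :
    (D.toFun (ofCov ν) x (v, 0)).2 = dualAt D.nablaTT ν x v := by
  ext w
  obtain ⟨Y, hY, rfl⟩ := exists_vSmoothAt w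
  have h : dirDeriv (fun y ↦ ν y (Y y)) x v =
    ν x (D.nablaTT Y x v) + (D.toFun (ofCov ν) x (v, 0)).2 (Y x) := hP.vec_cov hY hν (v, 0)
  rw [dualAt_apply _ hν.coDiffAt hY.vDiffAt, h]
  ring

/-- The `TM`-component of `D_a σ` only depends on the `TM`-components of `a` and `σ`. -/
lemma fst_toFun (hT : D.KTorsionFree K H) (hP : D.PairingCompatible) {x : M}
    {σ : GenField E M} (hσ : GenSmoothAt σ x) (a : GenTangent E x) :
    (D.toFun σ x a).1 = D.nablaTT (fun y ↦ (σ y).1) x a.1 := by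
  rw [D.toFun_eq_add hσ.genDiffAt, add_apply, Prod.fst_add,
    D.toFun_eq_horizontal_add_vertical _ _ a,
    D.toFun_eq_horizontal_add_vertical (ofCov _) _ a, Prod.fst_add, Prod.fst_add,
    fst_vertical_ofVec hT hP hσ.1, fst_vertical_ofCov hT hP hσ.2, fst_horizontal_ofCov hT hP hσ.2,
    add_zero, add_zero, add_zero]
  rfl

lemma snd_toFun (hT : D.KTorsionFree K H) (hP : D.PairingCompatible) {x : M}
    {σ : GenField E M} (hσ : GenSmoothAt σ x) (a : GenTangent E x) :
    (D.toFun σ x a).2 = (D.toFun (ofVec fun y ↦ (σ y).1) x (a.1, 0)).2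
      + dualAt D.nablaTT (fun y ↦ (σ y).2) x a.1
      + (D.toFun (ofVec fun y ↦ (σ y).1) x (0, a.2)).2 := by
  rw [D.toFun_eq_add hσ.genDiffAt, add_apply, Prod.snd_add,
    D.toFun_eq_horizontal_add_vertical _ _ a,
    D.toFun_eq_horizontal_add_vertical (ofCov _) _ a, Prod.snd_add, Prod.snd_add,
    snd_vertical_ofCov hT hP hσ.2, snd_horizontal_ofCov hP hσ.2, add_zero]
  abel

lemma gamma_swap_outer (hT : D.KTorsionFree K H) {x : M} {X Y Z : VField E M}
    (hX : VSmoothAt X x) (hZ : VSmoothAt Z x) : D.gamma H X Y Z x = D.gamma H Z Y X x := by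
  have h := congrArg (fun f ↦ f (Y x)) (hT.nablaTsT_sub hX hZ)
  simp only [add_apply, sub_apply,
    zero_apply] at h
  have h1 := H.swap_right x (X x) (Z x) (Y x)
  have h2 := H.swap_left x (Z x) (Y x) (X x)
  have h3 := H.swap_right x (Y x) (Z x) (X x)
  have h4 := H.swap_left x (Y x) (X x) (Z x)
  simp only [gamma]
  linarith

end GenConn

end

section

variable {E : Type*} [NormedAddCommGroup E] [NormedSpace ℝ E]
  {M : Type*} [TopologicalSpace M] [ChartedSpace E M]
  [IsManifold 𝓘(ℝ, E) ∞ M] [FiniteDimensional ℝ E]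

/-! ### The `K`-curvature of a torsion-free compatible generalized connection -/

namespace GenConn

variable {D : GenConn E M} {K : AffineConn E M} {H : ThreeForm E M}

lemma fst_vPart (hT : D.KTorsionFree K H) (hP : D.PairingCompatible) {x : M}
    {σ : GenField E M} (hσ : GenSmoothAt σ x) (ν : CoField E M) : (D.vPart ν σ x).1 = 0 :=
  (fst_toFun hT hP hσ _).trans (map_zero _)

lemma snd_vPart (hT : D.KTorsionFree K H) (hP : D.PairingCompatible) {x : M}
    {σ : GenField E M} (hσ : GenSmoothAt σ x) (ν : CoField E M) :
    (D.vPart ν σ x).2 = D.vTsT ν (fun y ↦ (σ y).1) x := by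
  refine (snd_toFun hT hP hσ _).trans ?_
  rw [toFun_apply_zero, dualAt_zero_right _ hσ.2.coDiffAt]
  simp only [Prod.snd_zero, zero_add]
  rfl

lemma fst_nabla_nabla (hT : D.KTorsionFree K H) (hP : D.PairingCompatible) {x : M}
    {X Y : VField E M} {σ : GenField E M} (hY : ∀ᶠ y in 𝓝 x, VSmoothAt Y y)
    (hσ : ∀ᶠ y in 𝓝 x, GenSmoothAt σ y) :
    (D.nabla X (D.nabla Y σ) x).1
      = D.nablaTT (fun y ↦ D.nablaTT (fun z ↦ (σ z).1) y (Y y)) x (X x) := by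
  have h : GenSmoothAt (D.nabla Y σ) x := D.smooth hY.self_of_nhds.ofVec hσ.self_of_nhds
  refine (fst_toFun hT hP h _).trans ?_
  rw [affineConn_congr D.nablaTT h.1.vDiffAt (hσ.mono fun y hy ↦ fst_toFun hT hP hy (Y y, 0))]

/-- The `TM`-component of the `K`-curvature is the curvature of `∇^{TT}`. -/
lemma fst_kCurv (hT : D.KTorsionFree K H) (hP : D.PairingCompatible) {x : M}
    {a b σ : GenField E M} (ha : ∀ᶠ y in 𝓝 x, GenSmoothAt a y)
    (hb : ∀ᶠ y in 𝓝 x, GenSmoothAt b y) (hσ : ∀ᶠ y in 𝓝 x, GenSmoothAt σ y) :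
    (D.kCurv K H a b σ x).1
      = Frame.curvTT D (fun y ↦ (a y).1) (fun y ↦ (b y).1) (fun y ↦ (σ y).1) x := by
  have hs := hσ.self_of_nhds
  have hV : ∀ {ν : CoField E M}, CoSmoothAt ν x → GenSmoothAt (D.vPart ν σ) x :=
    fun hν ↦ D.smooth hν.ofCov hs
  have h1 : ∀ {X : VField E M} {ν : CoField E M}, VSmoothAt X x → CoSmoothAt ν x →
      (D.nablaV K X ν σ x).1 = 0 := by
    intro X ν hX hν
    have e1 : (D.nabla X (D.vPart ν σ) x).1 = 0 := by
      refine (fst_toFun hT hP (hV hν) _).trans ?_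
      rw [affineConn_eq_zero D.nablaTT (hV hν).1.vDiffAt
        (hσ.mono fun y hy ↦ fst_vPart hT hP hy ν)]
      rfl
    have e2 : (D.vPart ν (D.nabla X σ) x).1 = 0 := fst_vPart hT hP (D.smooth hX.ofVec hs) ν
    simp only [nablaV, Prod.fst_sub, e1, e2, fst_vPart hT hP hs, sub_zero]
  have h2 : ∀ {μ ν : CoField E M}, CoSmoothAt μ x → CoSmoothAt ν x →
      (D.curvV μ ν σ x).1 = 0 := by
    intro μ ν hμ hν
    simp only [curvV, Prod.fst_sub, fst_vPart hT hP (hV hμ), fst_vPart hT hP (hV hν), sub_zero]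
  have ha' := ha.self_of_nhds
  have hb' := hb.self_of_nhds
  have h3 := fst_nabla_nabla (X := fun y ↦ (a y).1) hT hP (hb.mono fun y hy ↦ hy.1) hσ
  have h4 := fst_nabla_nabla (X := fun y ↦ (b y).1) hT hP (ha.mono fun y hy ↦ hy.1) hσ
  have h5 : (D.nabla (VectorField.mlieBracket 𝓘(ℝ, E) (fun y ↦ (a y).1) fun y ↦ (b y).1) σ x).1
      = D.nablaTT (fun z ↦ (σ z).1) x
        (VectorField.mlieBracket 𝓘(ℝ, E) (fun y ↦ (a y).1) (fun y ↦ (b y).1) x) :=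
    fst_toFun hT hP hs _
  simp only [kCurv, Prod.fst_add, Prod.fst_sub, h1 ha'.1 hb'.2, h1 hb'.1 ha'.2, h2 ha'.2 hb'.2,
    add_zero, sub_zero, curvNabla, h3, h4, h5, fst_vPart hT hP hs, Frame.curvTT]

/-- The `T*M`-component of `(∇_X V)_ν σ`, with `∇^K` eliminated in favour of `∇^{TT}` and
`V^{T*T}`. -/
lemma snd_nablaV (hT : D.KTorsionFree K H) (hP : D.PairingCompatible) {x : M}
    {X : VField E M} {ν : CoField E M} {σ : GenField E M} (hX : VSmoothAt X x)
    (hν : CoSmoothAt ν x) (hσ : ∀ᶠ y in 𝓝 x, GenSmoothAt σ y) :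
    (D.nablaV K X ν σ x).2
      = dualAt D.nablaTT (D.vTsT ν fun y ↦ (σ y).1) x (X x)
        - D.vTsT ν (fun y ↦ D.nablaTT (fun z ↦ (σ z).1) y (X y)) x
        - (D.toFun (ofVec fun y ↦ (σ y).1) x
            (0, dualAt D.nablaTT ν x (X x) - D.vTsT ν X x)).2 := by
  have hs := hσ.self_of_nhds
  have hV : GenSmoothAt (D.vPart ν σ) x := D.smooth hν.ofCov hs
  have hN : GenSmoothAt (D.nabla X σ) x := D.smooth hX.ofVec hs
  have e1 : (D.nabla X (D.vPart ν σ) x).2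
      = dualAt D.nablaTT (D.vTsT ν fun y ↦ (σ y).1) x (X x) := by
    refine (snd_toFun hT hP hV _).trans ?_
    have h0 := D.toFun_ofVec_eq_zero hV.1.vDiffAt (hσ.mono fun y hy ↦ fst_vPart hT hP hy ν)
    rw [h0, h0, dualAt_congr D.nablaTT hV.2.coDiffAt
      (hσ.mono fun y hy ↦ snd_vPart hT hP hy ν)]
    simp
  have e2 : (D.vPart ν (D.nabla X σ) x).2
      = D.vTsT ν (fun y ↦ D.nablaTT (fun z ↦ (σ z).1) y (X y)) x := by
    have he : ∀ᶠ y in 𝓝 x, (D.nabla X σ y).1 = D.nablaTT (fun z ↦ (σ z).1) y (X y) :=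
      hσ.mono fun y hy ↦ fst_toFun hT hP hy (X y, 0)
    rw [snd_vPart hT hP hN]
    exact congrArg Prod.snd (D.toFun_ofVec_vertical_congr hN.1.vDiffAt
      (hN.1.vDiffAt.congr (he.mono fun _ ↦ Eq.symm)) he.self_of_nhds (ν x))
  have e3 : (D.vPart (fun y ↦ dualAt K ν y (X y)) σ x).2
      = (D.toFun (ofVec fun y ↦ (σ y).1) x
            (0, dualAt D.nablaTT ν x (X x) - D.vTsT ν X x)).2 := by
    have hk : dualAt K ν x (X x) = dualAt D.nablaTT ν x (X x) - D.vTsT ν X x := by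
      rw [hT.dualAt_eq hX hν, ← snd_horizontal_ofCov hP hν]
      rfl
    rw [snd_vPart hT hP hs, ← hk]
    rfl
  simp only [nablaV, Prod.snd_sub, e1, e2, e3]

lemma snd_vPart_vPart (hT : D.KTorsionFree K H) (hP : D.PairingCompatible) {x : M}
    {ν η : CoField E M} {σ : GenField E M} (hη : CoSmoothAt η x)
    (hσ : ∀ᶠ y in 𝓝 x, GenSmoothAt σ y) : (D.vPart ν (D.vPart η σ) x).2 = 0 := by
  have hV : GenSmoothAt (D.vPart η σ) x := D.smooth hη.ofCov hσ.self_of_nhds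
  rw [snd_vPart hT hP hV]
  exact congrArg Prod.snd (D.toFun_ofVec_eq_zero hV.1.vDiffAt
    (hσ.mono fun y hy ↦ fst_vPart hT hP hy η) (0, ν x))

/-- With a covector in the first argument, only the derivative of `V` contributes to the
`T*M`-component of the `K`-curvature. -/
lemma snd_kCurv_ofCov (hT : D.KTorsionFree K H) (hP : D.PairingCompatible) {x : M}
    {ν : CoField E M} {b σ : GenField E M} (hν : CoSmoothAt ν x) (hb : GenSmoothAt b x)
    (hσ : ∀ᶠ y in 𝓝 x, GenSmoothAt σ y) :
    (D.kCurv K H (ofCov ν) b σ x).2 = -(D.nablaV K (fun y ↦ (b y).1) ν σ x).2 := by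
  have h1 : D.curvNabla H (fun _ ↦ 0) (fun y ↦ (b y).1) σ x = 0 := by
    have e : VectorField.mlieBracket 𝓘(ℝ, E) (fun _ ↦ 0 : VField E M) (fun y ↦ (b y).1)
        = fun _ ↦ 0 := VectorField.mlieBracket_zero_left
    simp only [curvNabla, nabla_zero, e, H.toFun_zero_left, vPart, zero_apply, toFun_apply_zero]
    simp [nabla, toFun_zero_apply]
  have h2 : D.nablaV K (fun _ ↦ 0) (fun y ↦ (b y).2) σ x = 0 := by
    simp only [nablaV, nabla_zero, vPart, dualAt_zero_right K hb.2.coDiffAt, toFun_apply_zero,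
      toFun_zero_apply, sub_zero]
  have h3 : (D.curvV ν (fun y ↦ (b y).2) σ x).2 = 0 := by
    simp only [curvV, Prod.snd_sub, snd_vPart_vPart hT hP hν hσ, snd_vPart_vPart hT hP hb.2 hσ,
      sub_zero]
  have h : D.kCurv K H (ofCov ν) b σ x = D.curvNabla H (fun _ ↦ 0) (fun y ↦ (b y).1) σ x
    + D.curvV ν (fun y ↦ (b y).2) σ x + D.nablaV K (fun _ ↦ 0) (fun y ↦ (b y).2) σ x
    - D.nablaV K (fun y ↦ (b y).1) ν σ x := rfl
  rw [h, h1, h2, Prod.snd_sub, Prod.snd_add, Prod.snd_add, h3]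
  simp

end GenConn

end

section

variable {E : Type*} [NormedAddCommGroup E] [NormedSpace ℝ E]
  {M : Type*} [TopologicalSpace M] [ChartedSpace E M]
  [IsManifold 𝓘(ℝ, E) ∞ M]

/-! ### Components in a local frame -/

namespace Frame

lemma curvTT_zero_middle (D : GenConn E M) (X Z : VField E M) (x : M) :
    curvTT D X (fun _ ↦ 0) Z x = 0 := by
  have e : VectorField.mlieBracket 𝓘(ℝ, E) X (fun _ ↦ 0 : VField E M) x = 0 :=
    congrFun VectorField.mlieBracket_zero_right x
  have e2 : D.nablaTT (fun _ ↦ 0) x = 0 := congrFun D.nablaTT.zero x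
  simp [curvTT, e, e2]

lemma curvTT_zero_right (D : GenConn E M) (X Y : VField E M) (x : M) :
    curvTT D X Y (fun _ ↦ 0) x = 0 := by
  have e2 : ∀ y, D.nablaTT (fun _ ↦ 0) y = 0 := congrFun D.nablaTT.zero
  simp [curvTT, e2]

variable {ι : Type*} [DecidableEq ι] (F : Frame E M ι)

lemma eventually_mem {x : M} (hx : x ∈ F.U) : ∀ᶠ y in 𝓝 x, y ∈ F.U :=
  F.isOpen_U.mem_nhds hx

lemma eventually_genSmoothAt_Elow {x : M} (hx : x ∈ F.U) (α : ι ⊕ ι) :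
    ∀ᶠ y in 𝓝 x, GenSmoothAt (F.Elow α) y := by
  filter_upwards [F.eventually_mem hx] with y hy
  rcases α with μ | μ
  · exact (F.smooth_e μ hy).ofVec
  · exact (F.smooth_θ μ hy).ofCov

section FiniteDimensional

variable [FiniteDimensional ℝ E]

lemma dualAt_θ_apply_e (D : GenConn E M) {x : M} (hx : x ∈ F.U) (μ ρ l : ι) :
    dualAt D.nablaTT (F.θ ρ) x (F.e μ x) (F.e l x) = -F.Γ D μ ρ l x := by
  have h : dirDeriv (fun y ↦ F.θ ρ y (F.e l y)) x (F.e μ x) = 0 := by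
    rw [dirDeriv_congr (g := fun _ ↦ if ρ = l then 1 else 0)
      ((F.eventually_mem hx).mono fun y hy ↦ F.dual ρ l hy), dirDeriv_const]
  rw [dualAt_apply _ (F.smooth_θ ρ hx).coDiffAt (F.smooth_e l hx).vDiffAt, h, zero_sub]
  rfl

lemma Vup_eq_zero {D : GenConn E M} {K : AffineConn E M} {H : ThreeForm E M}
    (hT : D.KTorsionFree K H) (hP : D.PairingCompatible) {x : M} (hx : x ∈ F.U)
    (μ ν ρ : ι) : F.Vup D μ ν ρ x = 0 := by
  have h : D.vTTs (F.θ μ) (F.θ ρ) x = 0 := GenConn.fst_vertical_ofCov hT hP (F.smooth_θ ρ hx) _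
  rw [Vup, h, map_zero]

end FiniteDimensional

variable [Fintype ι]

lemma sum_coeff_smul_e {x : M} (hx : x ∈ F.U) (v : TangentSpace 𝓘(ℝ, E) x) :
    ∑ l, F.θ l x v • F.e l x = v := by
  have hv : v ∈ Submodule.span ℝ (Set.range fun μ ↦ F.e μ x) := by
    rw [F.span hx]; trivial
  induction hv using Submodule.span_induction with
  | mem w hw =>
    obtain ⟨μ, rfl⟩ := hw
    simp [F.dual _ _ hx]
  | zero => simp
  | add v w _ _ hv hw => simp only [map_add, add_smul, Finset.sum_add_distrib, hv, hw]
  | smul c v _ hv => simp only [map_smul, smul_assoc, ← Finset.smul_sum, hv]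

lemma apply_eq_sum {x : M} (hx : x ∈ F.U) (ξ : TangentSpace 𝓘(ℝ, E) x →L[ℝ] ℝ)
    (v : TangentSpace 𝓘(ℝ, E) x) : ξ v = ∑ l, F.θ l x v * ξ (F.e l x) := by
  conv_lhs => rw [← F.sum_coeff_smul_e hx v]
  rw [map_sum]
  simp only [map_smul, smul_eq_mul]

lemma sum_coeff_smul_θ {x : M} (hx : x ∈ F.U) (ξ : TangentSpace 𝓘(ℝ, E) x →L[ℝ] ℝ) :
    ∑ l, ξ (F.e l x) • F.θ l x = ξ := by
  ext v
  rw [F.apply_eq_sum hx ξ v, sum_apply]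
  simp [mul_comm]

lemma vertical_sum_left (D : GenConn E M) {x : M} (hx : x ∈ F.U) (σ : GenField E M)
    (ξ : TangentSpace 𝓘(ℝ, E) x →L[ℝ] ℝ) (w : TangentSpace 𝓘(ℝ, E) x) :
    (D.toFun σ x (0, ξ)).2 w = ∑ l, ξ (F.e l x) * (D.toFun σ x (0, F.θ l x)).2 w := by
  set L : (TangentSpace 𝓘(ℝ, E) x →L[ℝ] ℝ) →ₗ[ℝ] ℝ :=
    { toFun := fun ζ ↦ (D.toFun σ x (0, ζ)).2 w
      map_add' := fun ζ η ↦ by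
        have h := (D.toFun σ x).map_add (0, ζ) (0, η)
        rw [Prod.mk_add_mk, add_zero] at h
        rw [h]
        rfl
      map_smul' := fun c ζ ↦ by
        have h := (D.toFun σ x).map_smul c (0, ζ)
        rw [Prod.smul_mk, smul_zero] at h
        rw [h]
        rfl }
  change L ξ = ∑ l, ξ (F.e l x) * L (F.θ l x)
  conv_lhs => rw [← F.sum_coeff_smul_θ hx ξ]
  rw [map_sum]
  simp only [map_smul, smul_eq_mul]

variable [FiniteDimensional ℝ E] (D : GenConn E M)

/-- `⟨e^ρ, ∇_{e_μ} Y⟩ = ∂_μ Y^ρ + Γ_μ{}^ρ{}_l Y^l`. -/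
lemma θ_nablaTT {x : M} (hx : x ∈ F.U) {Y : VField E M} (hY : VDiffAt Y x) (μ ρ : ι) :
    F.θ ρ x (D.nablaTT Y x (F.e μ x))
      = dirDeriv (fun y ↦ F.θ ρ y (Y y)) x (F.e μ x) + ∑ l, F.Γ D μ ρ l x * F.θ l x (Y x) := by
  have h := dualAt_apply D.nablaTT (F.smooth_θ ρ hx).coDiffAt hY (F.e μ x)
  rw [F.apply_eq_sum hx (dualAt _ _ _ _)] at h
  simp only [F.dualAt_θ_apply_e D hx, mul_neg, Finset.sum_neg_distrib] at h
  simp only [mul_comm (F.Γ D μ ρ _ x)]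
  linarith

/-- `V_ξ Y` is `C^∞`-linear in `Y`, hence determined by the frame and the components of `Y`. -/
lemma vertical_sum_right {x : M} (hx : x ∈ F.U) {Y : VField E M} (hY : VDiffAt Y x)
    (ξ : TangentSpace 𝓘(ℝ, E) x →L[ℝ] ℝ) (w : TangentSpace 𝓘(ℝ, E) x) :
    (D.toFun (ofVec Y) x (0, ξ)).2 w
      = ∑ l, F.θ l x (Y x) * (D.toFun (ofVec (F.e l)) x (0, ξ)).2 w := by
  have hL : ∀ {Z : VField E M}, VDiffAt Z x →
      TensorialAt.mkHom _ x (D.vertical_tensorial ξ) (Z x) = D.toFun (ofVec Z) x (0, ξ) :=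
    fun hZ ↦ TensorialAt.mkHom_apply (D.vertical_tensorial ξ) hZ
  rw [← hL hY]
  conv_lhs => rw [← F.sum_coeff_smul_e hx (Y x)]
  rw [map_sum, Prod.snd_sum, sum_apply]
  refine Finset.sum_congr rfl fun l _ ↦ ?_
  rw [map_smul, hL (F.smooth_e l hx).vDiffAt]
  rfl

variable {D} {K : AffineConn E M} {H : ThreeForm E M}

open GenConn

/-- The diagonal components of `∇^K V`. Eliminating `∇^K` replaces the covariant derivative built from
`∇^K` by the one built from `∇^{TT}`, at the cost of the term quadratic in `V^{T*T}`. -/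
lemma snd_nablaV_frame (hT : D.KTorsionFree K H) (hP : D.PairingCompatible) {x : M}
    (hx : x ∈ F.U) (μ ν ρ : ι) :
    (D.nablaV K (F.e μ) (F.θ ρ) (ofVec (F.e ν)) x).2 (F.e ρ x)
      = F.dVdown D μ ρ ρ ν x + ∑ σ, F.Vdown D ρ σ μ x * F.Vdown D σ ρ ν x := by
  have hσ := F.eventually_genSmoothAt_Elow hx (.inl ν)
  have hV : GenSmoothAt (D.vPart (F.θ ρ) (ofVec (F.e ν))) x :=
    D.smooth (F.smooth_θ ρ hx).ofCov (F.smooth_e ν hx).ofVec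
  have hN : GenSmoothAt (D.nabla (F.e μ) (ofVec (F.e ν))) x :=
    D.smooth (F.smooth_e μ hx).ofVec (F.smooth_e ν hx).ofVec
  have t1 : dualAt D.nablaTT (D.vTsT (F.θ ρ) (F.e ν)) x (F.e μ x) (F.e ρ x)
      = dirDeriv (F.Vdown D ρ ρ ν) x (F.e μ x) - ∑ l, F.Γ D μ l ρ x * F.Vdown D ρ l ν x := by
    have h := dualAt_apply D.nablaTT (ν := D.vTsT (F.θ ρ) (F.e ν)) hV.2.coDiffAt
      (F.smooth_e ρ hx).vDiffAt (F.e μ x)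
    rw [F.apply_eq_sum hx (D.vTsT (F.θ ρ) (F.e ν) x)] at h
    exact h
  have t2 : D.vTsT (F.θ ρ) (fun y ↦ D.nablaTT (F.e ν) y (F.e μ y)) x (F.e ρ x)
      = ∑ l, F.Γ D μ l ν x * F.Vdown D ρ ρ l x :=
    F.vertical_sum_right D hx (Y := fun y ↦ D.nablaTT (F.e ν) y (F.e μ y)) hN.1.vDiffAt _ _
  have t3 : (D.toFun (ofVec (F.e ν)) x
        (0, dualAt D.nablaTT (F.θ ρ) x (F.e μ x) - D.vTsT (F.θ ρ) (F.e μ) x)).2 (F.e ρ x)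
      = -∑ l, F.Γ D μ ρ l x * F.Vdown D l ρ ν x
        - ∑ l, F.Vdown D ρ l μ x * F.Vdown D l ρ ν x := by
    rw [F.vertical_sum_left D hx, ← Finset.sum_neg_distrib, ← Finset.sum_sub_distrib]
    refine Finset.sum_congr rfl fun l _ ↦ ?_
    rw [sub_apply, F.dualAt_θ_apply_e D hx]
    simp only [Vdown, vTsT, vPart]
    ring
  have h : (D.nablaV K (F.e μ) (F.θ ρ) (ofVec (F.e ν)) x).2 (F.e ρ x)
      = dualAt D.nablaTT (D.vTsT (F.θ ρ) (F.e ν)) x (F.e μ x) (F.e ρ x)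
        - D.vTsT (F.θ ρ) (fun y ↦ D.nablaTT (F.e ν) y (F.e μ y)) x (F.e ρ x)
        - (D.toFun (ofVec (F.e ν)) x
            (0, dualAt D.nablaTT (F.θ ρ) x (F.e μ x) - D.vTsT (F.θ ρ) (F.e μ) x)).2 (F.e ρ x) :=
    congrArg (fun f ↦ f (F.e ρ x))
      (snd_nablaV hT hP (F.smooth_e μ hx) (F.smooth_θ ρ hx) hσ)
  rw [h, t1, t2, t3, dVdown]
  ring

/-- The `K`-Ricci tensor in terms of the curvature of `∇^{TT}` and the derivative of `V`: in the trace
over `E_κ`, the half `e_ρ` sees the `TM`-component of the `K`-curvature, and the half `e^ρ` its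
`T*M`-component. -/
lemma ricK_eq (hT : D.KTorsionFree K H) (hP : D.PairingCompatible) {x : M}
    (hx : x ∈ F.U) (α β : ι ⊕ ι) :
    F.ricK D K H x α β
      = ∑ ρ, F.θ ρ x (curvTT D (F.e ρ) (fun y ↦ (F.Elow α y).1) (fun y ↦ (F.Elow β y).1) x)
        - ∑ ρ, (D.nablaV K (fun y ↦ (F.Elow α y).1) (F.θ ρ) (F.Elow β) x).2 (F.e ρ x) := by
  have hα := F.eventually_genSmoothAt_Elow hx α
  have hβ := F.eventually_genSmoothAt_Elow hx β
  rw [ricK, Fintype.sum_sum_type, sub_eq_add_neg, ← Finset.sum_neg_distrib]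
  congr 1
  · refine Finset.sum_congr rfl fun ρ _ ↦ ?_
    have h := fst_kCurv hT hP (F.eventually_genSmoothAt_Elow hx (.inl ρ)) hα hβ
    simp only [pairing, h]
    simp [Eup, Elow, ofCov, ofVec]
  · refine Finset.sum_congr rfl fun ρ _ ↦ ?_
    have h := snd_kCurv_ofCov hT hP (F.smooth_θ ρ hx) hα.self_of_nhds hβ
    change (D.kCurv K H (ofCov (F.θ ρ)) (F.Elow α) (F.Elow β) x).2 (F.e ρ x)
      + (0 : TangentSpace 𝓘(ℝ, E) x →L[ℝ] ℝ) _ = _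
    rw [h]
    simp

lemma ricK_inr_left (hT : D.KTorsionFree K H) (hP : D.PairingCompatible) {x : M}
    (hx : x ∈ F.U) (μ : ι) (β : ι ⊕ ι) : F.ricK D K H x (.inr μ) β = 0 := by
  have h : ∀ ρ, (D.nablaV K (fun _ ↦ 0) (F.θ ρ) (F.Elow β) x).2 = 0 := fun ρ ↦ by
    simp only [nablaV, nabla_zero, vPart, dualAt_zero_right K (F.smooth_θ ρ hx).coDiffAt,
      toFun_apply_zero, toFun_zero_apply, sub_zero, Prod.snd_zero]
  rw [F.ricK_eq hT hP hx]
  have e : (fun y ↦ (F.Elow (.inr μ) y).1) = fun _ ↦ 0 := rfl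
  simp [e, curvTT_zero_middle, h]

lemma ricK_inl_inr (hT : D.KTorsionFree K H) (hP : D.PairingCompatible) {x : M}
    (hx : x ∈ F.U) (μ ν : ι) : F.ricK D K H x (.inl μ) (.inr ν) = 0 := by
  have h : ∀ ρ, (D.nablaV K (F.e μ) (F.θ ρ) (F.Elow (.inr ν)) x).2 = 0 := fun ρ ↦ by
    have e1 : ∀ ξ, D.vTsT ξ (fun _ ↦ 0) = fun _ ↦ 0 := fun ξ ↦ funext fun y ↦
      congrArg Prod.snd (D.toFun_ofVec_zero_apply y (0, ξ y))
    have e2 : ∀ y, D.nablaTT (fun _ ↦ 0) y = 0 := congrFun D.nablaTT.zero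
    rw [snd_nablaV hT hP (F.smooth_e μ hx) (F.smooth_θ ρ hx)
      (F.eventually_genSmoothAt_Elow hx (.inr ν))]
    simp only [Elow, ofCov, e1, e2, zero_apply, dualAt_zero_left, toFun_ofVec_zero_apply,
      Prod.snd_zero, sub_zero]
  rw [F.ricK_eq hT hP hx]
  have e : (fun y ↦ (F.Elow (.inr ν) y).1) = fun _ ↦ 0 := rfl
  have e' : (fun y ↦ (F.Elow (.inl μ) y).1) = F.e μ := rfl
  simp [e, e', curvTT_zero_right, h]

lemma ricK_inl_inl (hT : D.KTorsionFree K H) (hP : D.PairingCompatible) {x : M}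
    (hx : x ∈ F.U) (μ ν : ι) :
    F.ricK D K H x (.inl μ) (.inl ν)
      = ∑ ρ, F.θ ρ x (curvTT D (F.e ρ) (F.e μ) (F.e ν) x)
        - (∑ σ, F.dVdown D μ σ σ ν x + ∑ σ, ∑ ρ, F.Vdown D σ ρ μ x * F.Vdown D ρ σ ν x) := by
  rw [F.ricK_eq hT hP hx, ← Finset.sum_add_distrib]
  simp only [← F.snd_nablaV_frame hT hP hx]
  rfl

lemma dVup_eq_zero (hT : D.KTorsionFree K H) (hP : D.PairingCompatible) {x : M}
    (hx : x ∈ F.U) (κ μ ν ρ : ι) : F.dVup D κ μ ν ρ x = 0 := by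
  have h : dirDeriv (F.Vup D μ ν ρ) x (F.e κ x) = 0 := by
    rw [dirDeriv_congr (g := fun _ ↦ 0) ((F.eventually_mem hx).mono fun y hy ↦
      F.Vup_eq_zero hT hP hy μ ν ρ), dirDeriv_const]
  simp [dVup, h, F.Vup_eq_zero hT hP hx]

/-- The `K`-scalar curvature in a local frame. Only the `TM`-`TM` block of the `K`-Ricci tensor is
nonzero, and it is contracted with `G^{μν} = g^{μν}`, while the terms containing `V^{TT*}` vanish. -/
lemma scalK_eq (hT : D.KTorsionFree K H) (hP : D.PairingCompatible) (g : Metric E M)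
    (B : TwoForm E M) {x : M} (hx : x ∈ F.U) :
    F.scalK D K H g B x
      = F.scalTT D g x
        + ∑ μ, ∑ ν, F.Gdown g B x μ ν *
            (∑ ρ, F.dVup D ρ μ ρ ν x
              + ∑ σ, ∑ ρ, F.Vdown D σ σ ρ x * F.Vup D μ ρ ν x)
        - ∑ μ, ∑ ν, F.Gup g B x μ ν *
            (∑ σ, F.dVdown D μ σ σ ν x
              + ∑ σ, ∑ ρ, F.Vdown D σ ρ μ x * F.Vdown D ρ σ ν x) := by
  simp only [F.Vup_eq_zero hT hP hx, F.dVup_eq_zero hT hP hx, scalK, Fintype.sum_sum_type,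
    F.ricK_inr_left hT hP hx, F.ricK_inl_inr hT hP hx, F.ricK_inl_inl hT hP hx, scalTT, Gup,
    mul_sub, Finset.sum_sub_distrib, mul_zero, Finset.sum_const_zero, add_zero, Sum.swap_inl]
  rfl

/-- Since the frame fields commute, only the iterated derivatives `∇_{e_κ} ∇_{e_μ} e_ν` contribute to
the curvature, and `θ_nablaTT` computes these from the Christoffel symbols. -/
lemma scalTT_eq_scalCoord (D : GenConn E M) (hF : F.Holonomic) (g : Metric E M)
    (B : TwoForm E M) {x : M} (hx : x ∈ F.U) : F.scalTT D g x = F.scalCoord D g B x := by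
  have key : ∀ κ ρ μ ν,
      F.θ ρ x (D.nablaTT (fun y ↦ D.nablaTT (F.e ν) y (F.e μ y)) x (F.e κ x))
        = dirDeriv (F.Γ D μ ρ ν) x (F.e κ x) + ∑ σ, F.Γ D κ ρ σ x * F.Γ D μ σ ν x := by
    intro κ ρ μ ν
    have hN : GenSmoothAt (D.nabla (F.e μ) (ofVec (F.e ν))) x :=
      D.smooth (F.smooth_e μ hx).ofVec (F.smooth_e ν hx).ofVec
    exact F.θ_nablaTT D hx (Y := fun y ↦ D.nablaTT (F.e ν) y (F.e μ y)) hN.1.vDiffAt κ ρ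
  refine Finset.sum_congr rfl fun μ _ ↦ Finset.sum_congr rfl fun ν _ ↦ congrArg _ ?_
  simp only [curvTT, hF _ _ x hx, map_zero, sub_zero, map_sub, key,
    Finset.sum_sub_distrib, Finset.sum_add_distrib]
  ring

end Frame

end

end CourantGeom

end

open CourantGeom
theorem mainTheorem5
    {E : Type*} [NormedAddCommGroup E] [NormedSpace ℝ E] [FiniteDimensional ℝ E]
    {M : Type*} [TopologicalSpace M] [ChartedSpace E M] [IsManifold 𝓘(ℝ, E) ∞ M]
    (H : ThreeForm E M) (D : GenConn E M) (K : AffineConn E M)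
    (hT : D.KTorsionFree K H) (hP : D.PairingCompatible) :
    -- the connection `K` is fixed: on one-forms `∇^K_X ν = ∇^{T*T*}_X ν - V^{T*T}_ν X`
    (∀ (x : M) (X : VField E M) (ν : CoField E M), VSmoothAt X x → CoSmoothAt ν x →
      dualAt K ν x (X x) = D.nablaTsTs X ν x - D.vTsT ν X x) ∧
    -- `∇^{TT}` is torsion-free
    D.nablaTT.torsion = 0 ∧
    -- the block form of `D`, evaluated on `a = X + ξ` and `b = Y + η`
    (∀ (x : M) (X Y : VField E M) (ξ η : CoField E M), VSmoothAt X x → VSmoothAt Y x →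
      CoSmoothAt ξ x → CoSmoothAt η x →
      (D.toFun (fun y ↦ (Y y, η y)) x (X x, ξ x)).1
          = D.nablaTT Y x (X x) + D.vTTs ξ η x ∧
      ∀ Z : VField E M, VSmoothAt Z x →
        (D.toFun (fun y ↦ (Y y, η y)) x (X x, ξ x)).2 (Z x)
          = ((1 / 2 : ℝ) * H.toFun x (X x) (Z x) (Y x) + D.gamma H X Z Y x)
            + dualAt D.nablaTT η x (X x) (Z x) + D.vTsT ξ Y x (Z x)) ∧
    -- `γ_{μνρ}` is symmetric in `(μ, ρ)` and antisymmetric in `(ν, ρ)`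
    (∀ (x : M) (X Y Z : VField E M), VSmoothAt X x → VSmoothAt Y x → VSmoothAt Z x →
      D.gamma H X Y Z x = D.gamma H Z Y X x ∧ D.gamma H X Y Z x = -D.gamma H X Z Y x) ∧
    -- `V^{TT*}` lies in `Γ(TM ⊗ Λ²TM)` and is symmetric in the first and third entry
    (∀ (x : M) (ξ η ζ : CoField E M), CoSmoothAt ξ x → CoSmoothAt η x → CoSmoothAt ζ x →
      ζ x (D.vTTs ξ η x) = -η x (D.vTTs ξ ζ x) ∧ ζ x (D.vTTs ξ η x) = ζ x (D.vTTs η ξ x)) ∧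
    -- `V^{T*T}` lies in `Γ(TM ⊗ Λ²T*M)`
    (∀ (x : M) (ξ : CoField E M) (Y Z : VField E M), CoSmoothAt ξ x → VSmoothAt Y x →
      VSmoothAt Z x → D.vTsT ξ Y x (Z x) = -D.vTsT ξ Z x (Y x)) ∧
    -- the `K`-scalar curvature, in every local frame and for every generalized metric
    (∀ {ι : Type*} [DecidableEq ι] [Fintype ι] (F : Frame E M ι) (g : Metric E M)
      (B : TwoForm E M) (x : M), x ∈ F.U →
      F.scalK D K H g B x
          = F.scalTT D g x
            + ∑ μ, ∑ ν, F.Gdown g B x μ ν *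
                (∑ ρ, F.dVup D ρ μ ρ ν x
                  + ∑ σ, ∑ ρ, F.Vdown D σ σ ρ x * F.Vup D μ ρ ν x)
            - ∑ μ, ∑ ν, F.Gup g B x μ ν *
                (∑ σ, F.dVdown D μ σ σ ν x
                  + ∑ σ, ∑ ρ, F.Vdown D σ ρ μ x * F.Vdown D ρ σ ν x) ∧
      (F.Holonomic → F.scalTT D g x = F.scalCoord D g B x)) := by
  refine ⟨fun x X ν hX hν ↦ hT.dualAt_eq hX hν, hT.torsion_nablaTT, ?_,
    fun x X Y Z hX hY hZ ↦ ⟨GenConn.gamma_swap_outer hT hX hZ, GenConn.gamma_swap_right hP hY hZ⟩,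
    ?_, fun x ξ Y Z hξ hY hZ ↦ hP.vec_vec hY hZ (0, ξ x),
    fun F g B x hx ↦ ⟨F.scalK_eq hT hP g B hx, fun hF ↦ F.scalTT_eq_scalCoord D hF g B hx⟩⟩
  · intro x X Y ξ η hX hY hξ hη
    have hσ : GenSmoothAt (fun y ↦ (Y y, η y)) x := ⟨hY, hη⟩
    have hV : D.vTTs ξ η x = 0 := GenConn.fst_vertical_ofCov hT hP hη (ξ x)
    refine ⟨by rw [hV, add_zero]; exact GenConn.fst_toFun hT hP hσ _, fun Z hZ ↦ ?_⟩
    rw [GenConn.snd_toFun hT hP hσ]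
    simp only [add_apply, GenConn.gamma, add_sub_cancel]
    rfl
  · intro x ξ η ζ hξ hη hζ
    have h1 : D.vTTs ξ η x = D.vTTs η ξ x := congrArg Prod.fst (hT.vertical hξ hη)
    exact ⟨hP.cov_cov hη hζ (0, ξ x), by rw [h1]⟩
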